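/- Let $X_{\mathbb R}$ be a finite-dimensional real vector space, $W\subset GL(X_{\mathbb R})$ a finite group generated by reflections, and let $\phi\in GL(X_{\mathbb R})$ normalize $W$, be such that the coset $W\phi$ has finite order, and preserve a chamber $C$ of the arrangement of reflecting hyperplanes of $W$. Let $S$ be the set of reflections through the walls of $C$, so that $(W,S)$ is a Coxeter system normalized by $\phi$; let $l$ be the length on $W$ with respect to $S$, let $w_0$ be the longest element of $W$ and, for $I\subset S$, let $w_I$ be the longest element of $W_I=\langle I\rangle$. Let $B^+$ (resp. $B$) be the Artin–Tits monoid (resp. group) of $(W,S)$, let $\mathbf w\in B^+$ be the canonical lift of $w\in W$ (given by any reduced expression), let $\mathbf I$ be the lift of $I\subset S$, and put $\boldsymbol\pi=\mathbf w_0^2$, $\boldsymbol\pi_{\mathbf I}=\mathbf w_I^2$. Denote again by $\phi$ the induced automorphisms of $B^+$ and $B$ (sending the generator of $s$ to that of $\phi s\phi^{-1}$); products with $\phi$ and the conjugation ${}^{\mathbf b\phi}(\cdot)$ are taken in the semidirect product with $\langle\phi\rangle$, where $\phi\,\mathbf b=\phi(\mathbf b)\,\phi$. Let $d\ge 1$,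 $\zeta_d=e^{2i\pi/d}$, and let $V$ be a subspace of $X=X_{\mathbb R}\otimes\mathbb C$ on which some element of $W\phi$ acts by the scalar $\zeta_d$. Then one may replace $V$ by another subspace in its $W$-orbit so that the following hold. (i) The pointwise stabilizer $C_W(V)$ equals $W_I$ for some $I\subset S$. (ii) The elements of $W\phi$ acting on $V$ by $\zeta_d$ form a coset $W_Iw\phi$, where $w\in W$ can be taken $I$-reduced, i.e. $l(sw)>l(w)$ for all $s\in I$. There is an element $\boldsymbol\pi/\boldsymbol\pi_{\mathbf I}\in B^+$ whose product with $\boldsymbol\pi_{\mathbf I}$, on either side, is $\boldsymbol\pi$, and with which the following holds for such $w$. If $d\neq1$, then $l(w)=\frac2d\,l(w_0w_I^{-1})$, and $l((w\phi)^i\phi^{-i})=i\,l(w)$ for every integer $i\ge 0$ with $2i\le d$. Moreover the canonical lift $\mathbf w$ of $w$ satisfies $${}^{\mathbf w\phi}\mathbf I=\mathbf I\quad\text{and}\quad(\mathbf w\phi)^d=\phi^d\,\boldsymbol\pi/\boldsymbol\pi_{\mathbf I}.$$ If $d=1$, then $w=1$, and the lift $\mathbf w:=\boldsymbol\pi/\boldsymbol\pi_{\mathbf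 I}$ of $w$ to $B^+$ satisfies ${}^{\mathbf w\phi}\mathbf I=\mathbf I$ and $(\mathbf w\phi)^d=\boldsymbol\pi/\boldsymbol\pi_{\mathbf I}\,\phi^d$. The relations on lifts hold in the braid monoid (with ${}^{\mathbf b\phi}\mathbf I=\mathbf I$ read as $\mathbf b\phi\,\mathbf I=\mathbf I\,\mathbf b\phi$) and hence also in $B\rtimes\langle\phi\rangle$, where $\boldsymbol\pi/\boldsymbol\pi_{\mathbf I}=\boldsymbol\pi\boldsymbol\pi_{\mathbf I}^{-1}$. -/

import Mathlib

open scoped TensorProduct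

namespace Braid

/-! ### Lengths, Artin monoid and Artin group attached to a set `S` of elements of a group -/

section

variable {G : Type*} [Group G]

/-- The length of `g` with respect to `S`: the smallest number of factors in an expression of `g`
as a product of elements of `S`. -/
noncomputable def wordLength (S : Set G) (g : G) : ℕ :=
  sInf {n | ∃ L : List S, (L.map (fun s => (s : G))).prod = g ∧ L.length = n}

/-- `w` has maximal `S`-length in the subgroup generated by `J`. -/
def IsLongestIn (S J : Set G) (w : G) : Prop :=
  w ∈ Subgroup.closure J ∧ ∀ v ∈ Subgroup.closure J, wordLength S v ≤ wordLength S w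

open Classical in
/-- The longest element `w_J` of the subgroup generated by `J` (a finite Coxeter group in the
applications, so that it exists and is unique). -/
noncomputable def longest (S J : Set G) : G :=
  Classical.epsilon (IsLongestIn S J)

/-- The alternating product `a b a ⋯` with `m` factors. -/
def altProd {M : Type*} [Monoid M] (a b : M) : ℕ → M
  | 0 => 1
  | n + 1 => a * altProd b a n

theorem map_altProd {M N : Type*} [Monoid M] [Monoid N] (f : M →* N) (a b : M) (n : ℕ) :
    f (altProd a b n) = altProd (f a) (f b) n := by
  induction n generalizing a b with
  | zero => simp [altProd]
  | succ n ih => simp [altProd, ih]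

/-- The braid relations `s t s ⋯ = t s t ⋯` with `m(s,t)` factors on both sides, `m(s,t)` being the
order of `s t` (no relation when this order is infinite). -/
def braidRel (S : Set G) (x y : FreeMonoid S) : Prop :=
  ∃ s t : S, x = altProd (FreeMonoid.of s) (FreeMonoid.of t) (orderOf (s * t : G)) ∧
    y = altProd (FreeMonoid.of t) (FreeMonoid.of s) (orderOf (s * t : G))

/-- The Artin-Tits (braid) monoid `B⁺`. -/
abbrev BraidMonoid (S : Set G) := PresentedMonoid (braidRel S)

/-- The braid relations as relators in the free group. -/
def braidRelators (S : Set G) : Set (FreeGroup S) :=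
  {r | ∃ s t : S, r = altProd (FreeGroup.of s) (FreeGroup.of t) (orderOf (s * t : G)) *
    (altProd (FreeGroup.of t) (FreeGroup.of s) (orderOf (s * t : G)))⁻¹}

/-- The Artin-Tits (braid) group `B`. -/
abbrev BraidGroup (S : Set G) := PresentedGroup (braidRelators S)

/-- The generator of the braid monoid attached to `s ∈ S`. -/
def monGen (S : Set G) (s : S) : BraidMonoid S := PresentedMonoid.of (braidRel S) s

/-- The generator of the braid group attached to `s ∈ S`. -/
def grpGen (S : Set G) (s : S) : BraidGroup S := PresentedGroup.of s

theorem monGen_rel (S : Set G) (s t : S) :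
    altProd (monGen S s) (monGen S t) (orderOf (s * t : G)) =
      altProd (monGen S t) (monGen S s) (orderOf (s * t : G)) := by
  have h := PresentedMonoid.mk_eq_mk_of_rel (rels := braidRel S) ⟨s, t, rfl, rfl⟩
  rw [map_altProd, map_altProd] at h
  exact h

theorem grpGen_rel (S : Set G) (s t : S) :
    altProd (grpGen S s) (grpGen S t) (orderOf (s * t : G)) =
      altProd (grpGen S t) (grpGen S s) (orderOf (s * t : G)) := by
  have h := PresentedGroup.one_of_mem (rels := braidRelators S) ⟨s, t, rfl⟩
  rw [map_mul, map_inv, map_altProd, map_altProd, mul_inv_eq_one] at h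
  exact h

/-- The universal property of the braid monoid. -/
def monLift {M : Type*} [Monoid M] (S : Set G) (f : S → M)
    (h : ∀ s t : S, altProd (f s) (f t) (orderOf (s * t : G)) =
      altProd (f t) (f s) (orderOf (s * t : G))) : BraidMonoid S →* M :=
  PresentedMonoid.lift f (by
    rintro a b ⟨s, t, rfl, rfl⟩
    simpa [map_altProd] using h s t)

@[simp] theorem monLift_monGen {M : Type*} [Monoid M] (S : Set G) (f : S → M)
    (h : ∀ s t : S, altProd (f s) (f t) (orderOf (s * t : G)) =
      altProd (f t) (f s) (orderOf (s * t : G))) (s : S) :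
    monLift S f h (monGen S s) = f s := rfl

/-- The universal property of the braid group. -/
def grpLift {H : Type*} [Group H] (S : Set G) (f : S → H)
    (h : ∀ s t : S, altProd (f s) (f t) (orderOf (s * t : G)) =
      altProd (f t) (f s) (orderOf (s * t : G))) : BraidGroup S →* H :=
  PresentedGroup.toGroup (f := f) (by
    rintro r ⟨s, t, rfl⟩
    rw [map_mul, map_inv, map_altProd, map_altProd, mul_inv_eq_one]
    simpa only [FreeGroup.lift_apply_of] using h s t)

@[simp] theorem grpLift_grpGen {H : Type*} [Group H] (S : Set G) (f : S → H)
    (h : ∀ s t : S, altProd (f s) (f t) (orderOf (s * t : G)) =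
      altProd (f t) (f s) (orderOf (s * t : G))) (s : S) :
    grpLift S f h (grpGen S s) = f s := by
  simp [grpLift, grpGen]

theorem grp_ext {H : Type*} [Group H] {S : Set G} {f g : BraidGroup S →* H}
    (h : ∀ s, f (grpGen S s) = g (grpGen S s)) : f = g :=
  PresentedGroup.ext h

/-- The canonical morphism `B⁺ → B`. -/
def toGrp (S : Set G) : BraidMonoid S →* BraidGroup S :=
  monLift S (grpGen S) (grpGen_rel S)

/-- `b ∈ B⁺` is a lift of `w`: some word in the generators represents `b` in `B⁺` and `w` in the
group. -/
def IsLift (S : Set G) (b : BraidMonoid S) (w : G) : Prop :=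
  ∃ L : List S, (L.map (fun s => (s : G))).prod = w ∧ (L.map (monGen S)).prod = b

/-- `b ∈ B⁺` is the canonical lift of `w`: it is represented by a word which is a shortest
expression of `w`. -/
def IsCanonicalLift (S : Set G) (b : BraidMonoid S) (w : G) : Prop :=
  ∃ L : List S, (L.map (fun s => (s : G))).prod = w ∧ L.length = wordLength S w ∧
    (L.map (monGen S)).prod = b

open Classical in
/-- The canonical lift of `w` in the braid monoid (independent of the reduced expression for
Coxeter groups). -/
noncomputable def canonicalLift (S : Set G) (w : G) : BraidMonoid S :=
  Classical.epsilon (fun b => IsCanonicalLift S b w)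

/-- `π_J`, the square of the canonical lift of the longest element `w_J`. -/
noncomputable def fullTwist (S J : Set G) : BraidMonoid S :=
  canonicalLift S (longest S J) ^ 2

/-- The lift to `B⁺` of a subset `I` of `S`. -/
def liftSubset (S I : Set G) : Set (BraidMonoid S) :=
  monGen S '' {s | (s : G) ∈ I}

/-! Functoriality under conjugation by an element `φ` normalizing `S`. -/

/-- Conjugation by `φ` as a permutation of `S`. -/
def conjPerm (S : Set G) (φ : G) (h : ∀ s, s ∈ S ↔ φ * s * φ⁻¹ ∈ S) : Equiv.Perm S where
  toFun s := ⟨φ * s * φ⁻¹, (h s).1 s.2⟩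
  invFun s := ⟨φ⁻¹ * s * φ, (h _).2 (by simp [mul_assoc])⟩
  left_inv s := by ext; simp [mul_assoc]
  right_inv s := by ext; simp [mul_assoc]

theorem orderOf_conjPerm (S : Set G) (φ : G) (h : ∀ s, s ∈ S ↔ φ * s * φ⁻¹ ∈ S) (s t : S) :
    orderOf ((conjPerm S φ h s : G) * (conjPerm S φ h t : G)) = orderOf (s * t : G) := by
  have : (conjPerm S φ h s : G) * (conjPerm S φ h t : G) = MulAut.conj φ (s * t : G) := by
    simp [conjPerm, mul_assoc]
  rw [this]
  exact orderOf_injective (MulAut.conj φ).toMonoidHom (MulAut.conj φ).injective _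

theorem orderOf_conjPerm_symm (S : Set G) (φ : G) (h : ∀ s, s ∈ S ↔ φ * s * φ⁻¹ ∈ S) (s t : S) :
    orderOf (((conjPerm S φ h).symm s : G) * ((conjPerm S φ h).symm t : G)) =
      orderOf (s * t : G) := by
  rw [← orderOf_conjPerm S φ h]; simp

/-- The automorphism of the braid monoid induced by `φ`; it sends the generator of `s` to the
generator of `φ s φ⁻¹`. -/
def monAut (S : Set G) (φ : G) (h : ∀ s, s ∈ S ↔ φ * s * φ⁻¹ ∈ S) : MulAut (BraidMonoid S) :=
  MonoidHom.toMulEquiv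
    (monLift S (fun s => monGen S (conjPerm S φ h s)) (fun s t => by
      rw [← orderOf_conjPerm S φ h s t]; exact monGen_rel S _ _))
    (monLift S (fun s => monGen S ((conjPerm S φ h).symm s)) (fun s t => by
      rw [← orderOf_conjPerm_symm S φ h s t]; exact monGen_rel S _ _))
    (PresentedMonoid.ext _ (fun s => by
      change monGen S _ = monGen S s
      simp))
    (PresentedMonoid.ext _ (fun s => by
      change monGen S _ = monGen S s
      simp))

/-- The automorphism of the braid group induced by `φ`. -/
def grpAut (S : Set G) (φ : G) (h : ∀ s, s ∈ S ↔ φ * s * φ⁻¹ ∈ S) : MulAut (BraidGroup S) :=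
  MonoidHom.toMulEquiv
    (grpLift S (fun s => grpGen S (conjPerm S φ h s)) (fun s t => by
      rw [← orderOf_conjPerm S φ h s t]; exact grpGen_rel S _ _))
    (grpLift S (fun s => grpGen S ((conjPerm S φ h).symm s)) (fun s t => by
      rw [← orderOf_conjPerm_symm S φ h s t]; exact grpGen_rel S _ _))
    (grp_ext (fun s => by simp))
    (grp_ext (fun s => by simp))

theorem monAut_monGen (S : Set G) (φ : G) (h : ∀ s, s ∈ S ↔ φ * s * φ⁻¹ ∈ S) (s : S) :
    monAut S φ h (monGen S s) = monGen S (conjPerm S φ h s) := rfl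

theorem grpAut_grpGen (S : Set G) (φ : G) (h : ∀ s, s ∈ S ↔ φ * s * φ⁻¹ ∈ S) (s : S) :
    grpAut S φ h (grpGen S s) = grpGen S (conjPerm S φ h s) := by
  simp [grpAut, MonoidHom.toMulEquiv]

end

/-- The product `b · F(b) ⋯ F^{n-1}(b)`, that is the component in `M` of `(b F)^n = (⋯) F^n` in the
semidirect product of `M` by the powers of `F`. -/
def twistedPow {M : Type*} [Monoid M] (F : MulAut M) (b : M) (n : ℕ) : M :=
  ((List.range n).map (fun i => (F ^ i) b)).prod

end Braid

namespace ReflCoset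

open Braid

variable {E : Type*} [AddCommGroup E] [Module ℝ E]

/-! ### Real reflection groups and chambers -/

/-- A linear automorphism of the form `y ↦ y - f(y) x` with `f(x) = 2`. -/
def IsReflection (s : E ≃ₗ[ℝ] E) : Prop :=
  ∃ (x : E) (f : Module.Dual ℝ E) (h : f x = 2), s = Module.reflection h

/-- `C` is a chamber of the arrangement of the reflecting hyperplanes of `W`: the set of all points
that lie strictly on the same side as a given point `x`, which is outside all the hyperplanes, of
every hyperplane (for a finite arrangement these sets are the connected components of the
complement of the union of the hyperplanes). -/
def IsChamber (W : Subgroup (E ≃ₗ[ℝ] E)) (C : Set E) : Prop :=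
  ∃ x : E, (∀ s ∈ W, IsReflection s → s x ≠ x) ∧
    C = {y | ∀ s ∈ W, IsReflection s → ∀ z ∈ segment ℝ x y, s z ≠ z}

/-- The reflections of `W` through the walls of `C`. A reflecting hyperplane is a wall of `C` if it
contains a point which is in no other reflecting hyperplane and which is in the closure of `C`. -/
def wallReflections (W : Subgroup (E ≃ₗ[ℝ] E)) (C : Set E) : Set (E ≃ₗ[ℝ] E) :=
  {s | s ∈ W ∧ IsReflection s ∧ ∃ p : E, s p = p ∧
    (∀ t ∈ W, IsReflection t → t p = p → t = s) ∧ ∃ c ∈ C, openSegment ℝ p c ⊆ C}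

end ReflCoset

/-- A finite order real reflection coset `W φ` on `E`, together with a chamber preserved
by `φ`. -/
structure RealReflectionCoset (E : Type*) [AddCommGroup E] [Module ℝ E] where
  /-- the finite reflection group -/
  W : Subgroup (E ≃ₗ[ℝ] E)
  finite_W : Finite W
  closure_reflections : Subgroup.closure {s | s ∈ W ∧ ReflCoset.IsReflection s} = W
  /-- the element defining the coset -/
  φ : E ≃ₗ[ℝ] E
  φ_mem_normalizer : φ ∈ Subgroup.normalizer (W : Set (E ≃ₗ[ℝ] E))
  finite_order : ∃ n : ℕ, 0 < n ∧ φ ^ n ∈ W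
  /-- the chamber -/
  C : Set E
  isChamber : ReflCoset.IsChamber W C
  φ_chamber : φ '' C = C

namespace RealReflectionCoset

open Braid ReflCoset

variable {E : Type*} [AddCommGroup E] [Module ℝ E] (D : RealReflectionCoset E)

/-- The set `S` of Coxeter generators of `W` determined by the chamber. -/
def S : Set (E ≃ₗ[ℝ] E) := wallReflections D.W D.C

theorem isReflection_conj {s : E ≃ₗ[ℝ] E} (hs : IsReflection s) (g : E ≃ₗ[ℝ] E) :
    IsReflection (g * s * g⁻¹) := by
  obtain ⟨x, f, h, rfl⟩ := hs
  refine ⟨g x, f ∘ₗ (g.symm : E →ₗ[ℝ] E), by simpa using h, ?_⟩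
  ext y
  change g (Module.reflection h (g.symm y)) = _
  simp [Module.reflection_apply]

theorem conj_mem_wall {W : Subgroup (E ≃ₗ[ℝ] E)} {C : Set E} {g : E ≃ₗ[ℝ] E}
    (hW : g ∈ Subgroup.normalizer (W : Set (E ≃ₗ[ℝ] E))) (hC : g '' C = C) {s : E ≃ₗ[ℝ] E}
    (hs : s ∈ wallReflections W C) : g * s * g⁻¹ ∈ wallReflections W C := by
  obtain ⟨h1, h2, p, hp, hp', c, hc, hcp⟩ := hs
  have hW' := Subgroup.mem_normalizer_iff.1 hW
  have hgi : ∀ y : E, g⁻¹ (g y) = y := fun y => g.symm_apply_apply y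
  refine ⟨(hW' s).1 h1, isReflection_conj h2 g, g p, ?_, ?_, g c, ?_, ?_⟩
  · change g (s (g⁻¹ (g p))) = g p
    rw [hgi, hp]
  · intro t ht ht2 htp
    have key : g⁻¹ * t * g = s := by
      apply hp'
      · apply (hW' _).2
        simpa [mul_assoc] using ht
      · simpa using isReflection_conj ht2 g⁻¹
      · change g⁻¹ (t (g p)) = p
        rw [htp, hgi]
    rw [← key]
    group
  · rw [← hC]; exact ⟨c, hc, rfl⟩
  · have := Set.image_mono (f := g) hcp
    rw [hC] at this
    have h3 := image_openSegment ℝ (g : E →ₗ[ℝ] E).toAffineMap p c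
    simp only [LinearMap.coe_toAffineMap, LinearEquiv.coe_coe] at h3
    rwa [h3] at this

/-- Conjugation by `φ` preserves `S`. -/
theorem mem_S_iff (s : E ≃ₗ[ℝ] E) : s ∈ D.S ↔ D.φ * s * D.φ⁻¹ ∈ D.S := by
  refine ⟨conj_mem_wall D.φ_mem_normalizer D.φ_chamber, fun h => ?_⟩
  have hC : (D.φ⁻¹ : E ≃ₗ[ℝ] E) '' D.C = D.C := by
    conv_lhs => rw [← D.φ_chamber]
    rw [← Set.image_comp]
    have hid : (D.φ⁻¹ : E ≃ₗ[ℝ] E) ∘ D.φ = id := funext fun y => D.φ.symm_apply_apply y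
    rw [hid, Set.image_id]
  have := conj_mem_wall (inv_mem D.φ_mem_normalizer) hC h
  have e : D.φ⁻¹ * (D.φ * s * D.φ⁻¹) * D.φ⁻¹⁻¹ = s := by group
  rwa [e] at this

/-- The `S`-length on `W`. -/
noncomputable def len (w : E ≃ₗ[ℝ] E) : ℕ := wordLength D.S w

/-- The longest element `w_0` of `W`. -/
noncomputable def w₀ : E ≃ₗ[ℝ] E := longest D.S D.S

/-- The longest element `w_I` of the standard parabolic subgroup `W_I`, for `I ⊆ S`. -/
noncomputable def wI (I : Set (E ≃ₗ[ℝ] E)) : E ≃ₗ[ℝ] E := longest D.S I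

/-- The braid monoid `B⁺` of `W`. -/
abbrev Bmon := BraidMonoid D.S

/-- The braid group `B` of `W`. -/
abbrev Bgrp := BraidGroup D.S

/-- The automorphism of `B⁺` induced by `φ`. -/
def φmon : MulAut D.Bmon := monAut D.S D.φ D.mem_S_iff

/-- The automorphism of `B` induced by `φ`. -/
def φgrp : MulAut D.Bgrp := grpAut D.S D.φ D.mem_S_iff

/-- The semidirect product `B ⋊ ⟨φ⟩`, with `⟨φ⟩` infinite cyclic. -/
abbrev BφGrp := D.Bgrp ⋊[zpowersHom (MulAut D.Bgrp) D.φgrp] Multiplicative ℤ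

/-- The morphism `B⁺ → B → B ⋊ ⟨φ⟩`. -/
def toBφ : D.Bmon →* D.BφGrp := SemidirectProduct.inl.comp (toGrp D.S)

/-- The element `φ` of `B ⋊ ⟨φ⟩`. -/
def φelt : D.BφGrp := SemidirectProduct.inr (Multiplicative.ofAdd 1)

/-- `π = 𝐰₀²` in the braid monoid. -/
noncomputable def piFull : D.Bmon := fullTwist D.S D.S

/-- `π_𝐈 = 𝐰_𝐈²` in the braid monoid. -/
noncomputable def piI (I : Set (E ≃ₗ[ℝ] E)) : D.Bmon := fullTwist D.S I

/-- The lift `𝐈 ⊆ B⁺` of `I ⊆ S`. -/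
def bI (I : Set (E ≃ₗ[ℝ] E)) : Set D.Bmon := liftSubset D.S I

/-- The conjugate of `𝐈` by `bφ` is `𝐈`, for `b` in the braid monoid: both in the form
`bφ 𝐈 = 𝐈 bφ` in `B⁺`, and in `B ⋊ ⟨φ⟩`. -/
def Stabilizes (b : D.Bmon) (I : Set (E ≃ₗ[ℝ] E)) : Prop :=
  (fun s => b * D.φmon s) '' D.bI I = (fun s => s * b) '' D.bI I ∧
  MulAut.conj (D.toBφ b * D.φelt) '' (D.toBφ '' D.bI I) = D.toBφ '' D.bI I

/-- The complexification of a real automorphism. -/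
noncomputable def cx (g : E ≃ₗ[ℝ] E) : (ℂ ⊗[ℝ] E) →ₗ[ℂ] (ℂ ⊗[ℝ] E) :=
  LinearMap.baseChange ℂ (g : E →ₗ[ℝ] E)

/-- `g` acts on the subspace `V` of the complexification by the scalar `ζ`. -/
def ActsBy (g : E ≃ₗ[ℝ] E) (ζ : ℂ) (V : Submodule ℂ (ℂ ⊗[ℝ] E)) : Prop :=
  ∀ v ∈ V, cx g v = ζ • v

/-- `C_W(V)`, the pointwise stabilizer of `V` in `W`. -/
def fixator (V : Submodule ℂ (ℂ ⊗[ℝ] E)) : Set (E ≃ₗ[ℝ] E) :=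
  {g | g ∈ D.W ∧ ∀ v ∈ V, cx g v = v}

/-- `w ∈ W` is `I`-reduced, the elements `g φ` of `W φ` acting on `V` by `ζ` being those with `g`
in the coset `W_I w`. -/
def IsReducedRep (ζ : ℂ) (V : Submodule ℂ (ℂ ⊗[ℝ] E)) (I : Set (E ≃ₗ[ℝ] E))
    (w : E ≃ₗ[ℝ] E) : Prop :=
  w ∈ D.W ∧
  (∀ g ∈ D.W, ActsBy (g * D.φ) ζ V ↔ ∃ u ∈ Subgroup.closure I, g = u * w) ∧
  ∀ s ∈ I, D.len w < D.len (s * w)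

end RealReflectionCoset

open Braid ReflCoset

/-! Lengths in `W` count hyperplanes, and the powers of `wφ` rotate a vector of `V`; the theorem
comes from counting how often this rotation crosses the hyperplanes.

Choose `v` in `V` whose real part `p` lies only on reflecting hyperplanes whose reflections fix all
of `V`, and move `V` by `W` until `p` is in the closure of the chamber (`exists_isGoodVector`). Then
`C_W(V)` is the stabilizer of `p`, which is generated by the walls through `p`; this gives `I`
(`IsGoodVector.fixator_eq`). The representative `w` is a shortest element of its coset.

Since `(wφ)^k p = Re(ζ^k v)` and `w` is `I`-reduced, the inversions of the `W`-component `cosetPow w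
k` of `(wφ)^k` are exactly the reflections not fixing `p` whose hyperplane separates `p` from
`(wφ)^k p` (`root_cosetPow_neg_iff`). For each reflection not fixing `p`, the values of its form at
the points `(wφ)^k p` are samples of a cosine, never zero, so for `2i ≤ d` exactly `2i` of the pairs
`(k, k+i)` in a period have opposite signs (`card_sign_changes`). Double counting gives `d ·
l(cosetPow w i) = 2i · l(w_I w_0)`, because the inversions of `κ = w_I w_0` are precisely the
reflections not fixing `p`. For `d ≥ 2` this yields `l(w)` and the additivity of lengths up to half
a turn.

In the braid monoid, `π/π_I` is the lift of `κ` times the lift of `κ⁻¹`. With `d = k + r + k`, `r ≤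
1`, the components `x`, `y` of `(wφ)^k`, `(wφ)^(k+r)` are prefixes of `κ`, and `(wφ)^d` has trivial
component. Lengths then add in `κ = x · x⁻¹κ`, `κ⁻¹ = κ⁻¹y · y⁻¹` and `x⁻¹κ · κ⁻¹y = x⁻¹y`, so
`π/π_I` is the product of the lifts of `x`, `x⁻¹y`, `y⁻¹`, which is the twisted power
(`twistedPow_eq_piQuot`).

The Coxeter theory used here (exchange, length as number of inversions, Matsumoto's theorem,
parabolic subgroups) is derived from the geometry of the chamber. -/

theorem LinearEquiv.inv_apply_apply {E : Type*} [AddCommGroup E] [Module ℝ E] (g : E ≃ₗ[ℝ] E)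
    (y : E) : g⁻¹ (g y) = y := g.symm_apply_apply y

theorem LinearEquiv.apply_inv_apply {E : Type*} [AddCommGroup E] [Module ℝ E] (g : E ≃ₗ[ℝ] E)
    (y : E) : g (g⁻¹ y) = y := g.apply_symm_apply y

namespace RealReflectionCoset

variable {E : Type*} [AddCommGroup E] [Module ℝ E] (D : RealReflectionCoset E)

/-! ### Reflections and positive roots -/

theorem finite_reflections : {t | t ∈ D.W ∧ IsReflection t}.Finite :=
  have := D.finite_W
  Set.Finite.subset (Set.toFinite (D.W : Set (E ≃ₗ[ℝ] E))) fun _ h => h.1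

/-- The finite set of reflections of `W`. -/
noncomputable def T : Finset (E ≃ₗ[ℝ] E) := D.finite_reflections.toFinset

theorem mem_T {t : E ≃ₗ[ℝ] E} : t ∈ D.T ↔ t ∈ D.W ∧ IsReflection t := by
  simp [T]

/-- A point of the chamber. -/
noncomputable def x₀ : E := D.isChamber.choose

theorem x₀_ne {t : E ≃ₗ[ℝ] E} (ht : t ∈ D.T) : t D.x₀ ≠ D.x₀ :=
  D.isChamber.choose_spec.1 t (D.mem_T.1 ht).1 (D.mem_T.1 ht).2

theorem C_eq : D.C = {y | ∀ s ∈ D.W, IsReflection s → ∀ z ∈ segment ℝ D.x₀ y, s z ≠ z} :=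
  D.isChamber.choose_spec.2

/-- Negating both the form and the vector does not change the reflection, so the sign at `x₀` can be
prescribed. -/
theorem exists_root {t : E ≃ₗ[ℝ] E} (ht : t ∈ D.T) : ∃ f : Module.Dual ℝ E,
    (∃ x, f x = 2 ∧ ∀ y, t y = y - f y • x) ∧ 0 < f D.x₀ := by
  obtain ⟨x, f, h, rfl⟩ := (D.mem_T.1 ht).2
  have h0 : f D.x₀ ≠ 0 := by
    intro h0
    apply D.x₀_ne ht
    simp [Module.reflection_apply, h0]
  rcases lt_or_gt_of_ne h0 with h1 | h1
  · refine ⟨-f, ⟨-x, by simpa using h, fun y => by simp [Module.reflection_apply]⟩, by simpa⟩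
  · exact ⟨f, ⟨x, h, fun y => by simp [Module.reflection_apply]⟩, h1⟩

open Classical in
/-- The linear form attached to the reflection `t` which is positive on the chamber. -/
noncomputable def root (t : E ≃ₗ[ℝ] E) : Module.Dual ℝ E :=
  if ht : t ∈ D.T then (D.exists_root ht).choose else 0

variable {D}

theorem root_spec {t : E ≃ₗ[ℝ] E} (ht : t ∈ D.T) :
    ∃ x, D.root t x = 2 ∧ ∀ y, t y = y - D.root t y • x := by
  rw [root, dif_pos ht]; exact (D.exists_root ht).choose_spec.1

theorem root_x₀_pos {t : E ≃ₗ[ℝ] E} (ht : t ∈ D.T) : 0 < D.root t D.x₀ := by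
  rw [root, dif_pos ht]; exact (D.exists_root ht).choose_spec.2

theorem root_eq_zero_iff {t : E ≃ₗ[ℝ] E} (ht : t ∈ D.T) {y : E} : D.root t y = 0 ↔ t y = y := by
  obtain ⟨x, hx, h⟩ := root_spec ht
  rw [h y, sub_eq_self, smul_eq_zero]
  refine ⟨Or.inl, fun h => h.resolve_right ?_⟩
  rintro rfl
  simp at hx

theorem root_self_apply {t : E ≃ₗ[ℝ] E} (ht : t ∈ D.T) (y : E) :
    D.root t (t y) = - D.root t y := by
  obtain ⟨x, hx, h⟩ := root_spec ht
  rw [h y, map_sub, map_smul, hx, smul_eq_mul]; ring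

theorem mul_self_of_mem_T {t : E ≃ₗ[ℝ] E} (ht : t ∈ D.T) : t * t = 1 := by
  obtain ⟨x, hx, h⟩ := root_spec ht
  ext y
  change t (t y) = y
  rw [h (t y), root_self_apply ht, h y]; simp

theorem inv_of_mem_T {t : E ≃ₗ[ℝ] E} (ht : t ∈ D.T) : t⁻¹ = t :=
  inv_eq_of_mul_eq_one_left (mul_self_of_mem_T ht)

/-- A form positive at `x₀` has no zero on the segment to `y` exactly when it is also positive at
`y`. -/
theorem mem_C_iff {y : E} : y ∈ D.C ↔ ∀ t ∈ D.T, 0 < D.root t y := by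
  rw [D.C_eq]
  constructor
  · intro h t ht
    by_contra! hneg
    have h0 := root_x₀_pos ht
    have hd : 0 < D.root t D.x₀ - D.root t y := by linarith
    -- The weights are those of the zero of the form on the segment.
    refine h t (D.mem_T.1 ht).1 (D.mem_T.1 ht).2
      ((-D.root t y / (D.root t D.x₀ - D.root t y)) • D.x₀ +
        (D.root t D.x₀ / (D.root t D.x₀ - D.root t y)) • y) ?_ ?_
    · refine ⟨_, _, div_nonneg (by linarith) hd.le, div_nonneg h0.le hd.le, ?_, rfl⟩
      field_simp
      ring
    · rw [← root_eq_zero_iff ht]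
      simp only [map_add, map_smul, smul_eq_mul]
      field_simp
      ring
  · rintro h s hs hs' z ⟨a, b, ha, hb, hab, rfl⟩ hz
    have ht : s ∈ D.T := D.mem_T.2 ⟨hs, hs'⟩
    rw [← root_eq_zero_iff ht] at hz
    simp only [map_add, map_smul, smul_eq_mul] at hz
    have h1 := root_x₀_pos ht
    have h2 := h s ht
    rcases ha.eq_or_lt with rfl | ha
    · simp at hab; subst hab; linarith
    · nlinarith [mul_pos ha h1, mul_nonneg hb h2.le]

variable (D) in
theorem x₀_mem_C : D.x₀ ∈ D.C := mem_C_iff.2 fun _ => root_x₀_pos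

theorem W_le_normalizer {g : E ≃ₗ[ℝ] E} (hg : g ∈ D.W) :
    g ∈ Subgroup.normalizer (D.W : Set (E ≃ₗ[ℝ] E)) := Subgroup.le_normalizer hg

theorem conj_mem_T {g t : E ≃ₗ[ℝ] E} (hg : g ∈ Subgroup.normalizer (D.W : Set (E ≃ₗ[ℝ] E)))
    (ht : t ∈ D.T) : g * t * g⁻¹ ∈ D.T := by
  rw [mem_T] at ht ⊢
  exact ⟨(Subgroup.mem_normalizer_iff.1 hg t).1 ht.1, isReflection_conj ht.2 g⟩

theorem conj_mem_T' {g t : E ≃ₗ[ℝ] E} (hg : g ∈ Subgroup.normalizer (D.W : Set (E ≃ₗ[ℝ] E)))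
    (ht : t ∈ D.T) : g⁻¹ * t * g ∈ D.T := by
  simpa using conj_mem_T (inv_mem hg) ht

/-- The form of a reflection is fixed only up to a positive factor, so conjugation transports forms
up to a nonzero constant; only the sign of this constant matters later. -/
theorem exists_root_apply {g t : E ≃ₗ[ℝ] E}
    (hg : g ∈ Subgroup.normalizer (D.W : Set (E ≃ₗ[ℝ] E))) (ht : t ∈ D.T) :
    ∃ c : ℝ, c ≠ 0 ∧ ∀ y, D.root t (g y) = c * D.root (g⁻¹ * t * g) y := by
  obtain ⟨x, hx, h⟩ := root_spec ht
  obtain ⟨x', hx', h'⟩ := root_spec (conj_mem_T' hg ht)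
  have key : ∀ y, D.root t (g y) = D.root t (g x') / 2 * D.root (g⁻¹ * t * g) y := by
    intro y
    have h1 : g ((g⁻¹ * t * g) y) = t (g y) := LinearEquiv.apply_inv_apply g _
    rw [h' y, h (g y), map_sub, map_smul, sub_right_inj] at h1
    have h2 := congrArg (D.root t) h1
    simp only [map_smul, hx, smul_eq_mul] at h2
    linarith
  refine ⟨_, fun h0 => ?_, key⟩
  have := key (g⁻¹ x)
  rw [LinearEquiv.apply_inv_apply, hx, h0, zero_mul] at this
  norm_num at this

/-- If `g` maps some point on the positive side of `g⁻¹tg` to the positive side of `t`, then it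
preserves signs. -/
theorem exists_root_apply_pos {g t : E ≃ₗ[ℝ] E}
    (hg : g ∈ Subgroup.normalizer (D.W : Set (E ≃ₗ[ℝ] E))) (ht : t ∈ D.T) {a : E}
    (ha : 0 < D.root (g⁻¹ * t * g) a) (ha' : 0 < D.root t (g a)) :
    ∃ c : ℝ, 0 < c ∧ ∀ y, D.root t (g y) = c * D.root (g⁻¹ * t * g) y := by
  obtain ⟨c, -, h⟩ := exists_root_apply hg ht
  refine ⟨c, ?_, h⟩
  rw [h a] at ha'
  exact pos_of_mul_pos_left ha' ha.le

theorem exists_root_apply_neg {g t : E ≃ₗ[ℝ] E}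
    (hg : g ∈ Subgroup.normalizer (D.W : Set (E ≃ₗ[ℝ] E))) (ht : t ∈ D.T) {a : E}
    (ha : 0 < D.root (g⁻¹ * t * g) a) (ha' : D.root t (g a) < 0) :
    ∃ c : ℝ, c < 0 ∧ ∀ y, D.root t (g y) = c * D.root (g⁻¹ * t * g) y := by
  obtain ⟨c, -, h⟩ := exists_root_apply hg ht
  refine ⟨c, ?_, h⟩
  rw [h a] at ha'
  exact neg_of_mul_neg_left ha' ha.le

theorem root_apply_ne_zero {g t : E ≃ₗ[ℝ] E}
    (hg : g ∈ Subgroup.normalizer (D.W : Set (E ≃ₗ[ℝ] E))) (ht : t ∈ D.T) :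
    D.root t (g D.x₀) ≠ 0 := by
  obtain ⟨c, hc, h⟩ := exists_root_apply hg ht
  rw [h]
  exact mul_ne_zero hc (root_x₀_pos (conj_mem_T' hg ht)).ne'

/-- Distinct reflections have distinct hyperplanes, as `W` is finite. -/
theorem eq_of_root_eq_smul {t t' : E ≃ₗ[ℝ] E} (ht : t ∈ D.T) (ht' : t' ∈ D.T) {c : ℝ}
    (h : ∀ y, D.root t' y = c * D.root t y) : t' = t := by
  obtain ⟨x, hx, hr⟩ := root_spec ht
  obtain ⟨x', hx', hr'⟩ := root_spec ht'
  set e := c • x' - x with he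
  have hc : c * D.root t x' = 2 := by rw [← h, hx']
  have h0 : D.root t e = 0 := by simp [he, hx, hc]
  -- Two reflections with proportional forms multiply to a transvection; its `n`-th power is the
  -- transvection by `n • e`, so finite order forces `e = 0`.
  have h1 : ∀ y, (t' * t) y = y + D.root t y • e := by
    intro y
    change t' (t y) = _
    rw [hr', h, root_self_apply ht, hr, he, smul_sub, smul_smul]
    rw [mul_neg, neg_smul, mul_comm]
    abel
  have h2 : ∀ n : ℕ, ∀ y, ((t' * t) ^ n) y = y + (n * D.root t y) • e := by
    intro n
    induction n with
    | zero => intro y; simp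
    | succ n ih =>
      intro y
      rw [pow_succ]
      change ((t' * t) ^ n) ((t' * t) y) = _
      rw [ih, h1, map_add, map_smul, h0]
      push_cast
      simp only [smul_zero, add_zero, add_smul, add_mul, one_mul]
      abel
  have := D.finite_W
  have hmem : t' * t ∈ D.W := mul_mem (D.mem_T.1 ht').1 (D.mem_T.1 ht).1
  obtain ⟨n, hn, hn'⟩ := isOfFinOrder_iff_pow_eq_one.1
    (isOfFinOrder_of_finite (⟨t' * t, hmem⟩ : D.W))
  have hn2 : (t' * t) ^ n = 1 := congrArg Subtype.val hn'
  have h3 := h2 n x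
  rw [hn2] at h3
  have h4 : ((n : ℝ) * D.root t x) • e = 0 := by
    simpa using h3
  have he0 : e = 0 := by
    rcases smul_eq_zero.1 h4 with h4 | h4
    · rw [hx] at h4
      have : (n : ℝ) ≠ 0 := by positivity
      exfalso; revert h4; positivity
    · exact h4
  have h5 : t' * t = 1 := by ext y; rw [h1, he0]; simp
  rw [← inv_of_mem_T ht]
  exact eq_inv_of_mul_eq_one_left h5

/-- A form vanishing on the kernel of `root t` is a multiple of it, which `eq_of_root_eq_smul`
excludes. -/
theorem exists_root_eq_zero_ne_zero {t t' : E ≃ₗ[ℝ] E} (ht : t ∈ D.T) (ht' : t' ∈ D.T)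
    (hne : t' ≠ t) : ∃ y, D.root t y = 0 ∧ D.root t' y ≠ 0 := by
  by_contra! hall
  obtain ⟨x, hx, hr⟩ := root_spec ht
  refine hne (eq_of_root_eq_smul ht ht' (c := D.root t' x / 2) fun y => ?_)
  have := hall (y - (D.root t y / 2) • x) (by simp [hx])
  rw [map_sub, map_smul, smul_eq_mul, sub_eq_zero] at this
  rw [this]; ring

end RealReflectionCoset

-- Perturbations are made along half-lines only, so that `E` needs no topology.
open Filter Topology in
theorem Module.Dual.eventually_pos {E : Type*} [AddCommGroup E] [Module ℝ E]
    (f : Module.Dual ℝ E) {x : E} (u : E) (h : 0 < f x) :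
    ∀ᶠ ε : ℝ in 𝓝[>] 0, 0 < f (x + ε • u) := by
  have hc : Continuous fun ε : ℝ => f x + ε * f u := by fun_prop
  have h0 : Tendsto (fun ε : ℝ => f x + ε * f u) (𝓝[>] 0) (𝓝 (f x)) := by
    have := hc.tendsto 0
    simp only [zero_mul, add_zero] at this
    exact this.mono_left nhdsWithin_le_nhds
  filter_upwards [h0.eventually (lt_mem_nhds h)] with ε hε
  simpa using hε

open Filter Topology in
theorem Module.Dual.eventually_ne_zero {E : Type*} [AddCommGroup E] [Module ℝ E]
    (f : Module.Dual ℝ E) (x : E) {u : E} (h : f u ≠ 0) :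
    ∀ᶠ ε : ℝ in 𝓝[>] 0, f (x + ε • u) ≠ 0 := by
  rcases lt_trichotomy (f x) 0 with hx | hx | hx
  · filter_upwards [Module.Dual.eventually_pos (-f) (x := x) u (by simpa using hx)] with ε hε
    simp only [LinearMap.neg_apply, Left.neg_pos_iff] at hε
    exact hε.ne
  · filter_upwards [self_mem_nhdsWithin] with ε hε
    have : ε ≠ 0 := ne_of_gt hε
    simp [hx, h, this]
  · filter_upwards [Module.Dual.eventually_pos f (x := x) u hx] with ε hε
    exact hε.ne'

namespace RealReflectionCoset

variable {E : Type*} [AddCommGroup E] [Module ℝ E] {D : RealReflectionCoset E}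

/-! ### Simple reflections -/

variable (D) in
/-- The point `p` is in the closure of the chamber. -/
def Dominant (p : E) : Prop := ∀ t ∈ D.T, 0 ≤ D.root t p

/-- If the form of `t ≠ s` were negative at `p`, it would vanish at a point of the open segment from
`p` to `c`, which lies in the chamber. Conversely `x₀` can serve as `c`. -/
theorem mem_S_iff_exists {s : E ≃ₗ[ℝ] E} :
    s ∈ D.S ↔ s ∈ D.T ∧ ∃ p, D.root s p = 0 ∧ ∀ t ∈ D.T, t ≠ s → 0 < D.root t p := by
  constructor
  · rintro ⟨h1, h2, p, hp, hp', c, hc, hcp⟩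
    have hs : s ∈ D.T := D.mem_T.2 ⟨h1, h2⟩
    refine ⟨hs, p, (root_eq_zero_iff hs).2 hp, fun t ht hts => ?_⟩
    have h0 : D.root t p ≠ 0 := fun h0 =>
      hts (hp' t (D.mem_T.1 ht).1 (D.mem_T.1 ht).2 ((root_eq_zero_iff ht).1 h0))
    by_contra! hneg
    have hneg := lt_of_le_of_ne hneg h0
    have hc' := mem_C_iff.1 hc t ht
    have hd : 0 < D.root t c - D.root t p := by linarith
    have hmem : (D.root t c / (D.root t c - D.root t p)) • p +
        (-D.root t p / (D.root t c - D.root t p)) • c ∈ D.C := hcp ⟨_, _, div_pos hc' hd,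
          div_pos (by linarith) hd, by field_simp; ring, rfl⟩
    have := mem_C_iff.1 hmem t ht
    simp only [map_add, map_smul, smul_eq_mul] at this
    refine this.ne' ?_
    field_simp
    ring
  · rintro ⟨hs, p, hp, hpos⟩
    refine ⟨(D.mem_T.1 hs).1, (D.mem_T.1 hs).2, p, (root_eq_zero_iff hs).1 hp, ?_, D.x₀,
      D.x₀_mem_C, ?_⟩
    · intro t ht ht' htp
      have htT : t ∈ D.T := D.mem_T.2 ⟨ht, ht'⟩
      by_contra hne
      exact (hpos t htT hne).ne' ((root_eq_zero_iff htT).2 htp)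
    · rintro z ⟨a, b, ha, hb, -, rfl⟩
      refine mem_C_iff.2 fun t ht => ?_
      simp only [map_add, map_smul, smul_eq_mul]
      have h1 := mul_pos hb (root_x₀_pos ht)
      rcases eq_or_ne t s with rfl | hne
      · rw [hp]; linarith
      · have h2 := mul_pos ha (hpos t ht hne)
        linarith

theorem mem_T_of_mem_S {s : E ≃ₗ[ℝ] E} (hs : s ∈ D.S) : s ∈ D.T := (mem_S_iff_exists.1 hs).1

theorem mem_W_of_mem_S {s : E ≃ₗ[ℝ] E} (hs : s ∈ D.S) : s ∈ D.W :=
  (D.mem_T.1 (mem_T_of_mem_S hs)).1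

/-- A simple reflection `s` preserves the sign of the roots other than its own. -/
theorem exists_root_simple_apply {s t : E ≃ₗ[ℝ] E} (hs : s ∈ D.S) (ht : t ∈ D.T) (hne : t ≠ s) :
    ∃ c : ℝ, 0 < c ∧ ∀ y, D.root t (s y) = c * D.root (s⁻¹ * t * s) y := by
  obtain ⟨hsT, p, hp, hpos⟩ := mem_S_iff_exists.1 hs
  have hsN := W_le_normalizer (mem_W_of_mem_S hs)
  refine exists_root_apply_pos hsN ht (a := p) (hpos _ (conj_mem_T' hsN ht) ?_) ?_
  · intro h
    apply hne
    have : s * (s⁻¹ * t * s) * s⁻¹ = s * s * s⁻¹ := by rw [h]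
    simpa [mul_assoc] using this
  · rw [(root_eq_zero_iff hsT).1 hp]
    exact hpos t ht hne

/-- A point on the negative side of some hyperplane is on the negative side of a wall. -/
theorem exists_simple_neg {y : E} (h : ∃ t ∈ D.T, D.root t y < 0) :
    ∃ s ∈ D.S, D.root s y < 0 := by
  classical
  set N := D.T.filter (fun t => D.root t y < 0) with hN
  have hNT : ∀ {t}, t ∈ N → t ∈ D.T := fun h => (Finset.mem_filter.1 h).1
  have hNy : ∀ {t}, t ∈ N → D.root t y < 0 := fun h => (Finset.mem_filter.1 h).2
  have hNne : N.Nonempty := by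
    obtain ⟨t, ht, hty⟩ := h
    exact ⟨t, Finset.mem_filter.2 ⟨ht, hty⟩⟩
  -- The segment from `c` to `y` meets the hyperplanes of `t` and `t'` at the same time exactly when
  -- the form indexed by `(t, t')` vanishes at `c`. None of these forms is zero, so a small move of
  -- `x₀` inside the chamber makes all crossing times distinct.
  let ι := {q : N × N // q.1 ≠ q.2}
  let f : ι → Module.Dual ℝ E := fun i =>
    D.root i.1.2 y • D.root i.1.1 - D.root i.1.1 y • D.root i.1.2
  obtain ⟨u, hu⟩ : ∃ u, ∀ i, f i u ≠ 0 := by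
    apply Module.Dual.exists_forall_ne_zero_of_forall_exists
    rintro ⟨⟨⟨t, ht⟩, ⟨t', ht'⟩⟩, hne⟩
    by_contra! hall
    apply hne
    have : t' = t := by
      refine eq_of_root_eq_smul (hNT ht) (hNT ht') (c := D.root t' y / D.root t y) fun z => ?_
      have h1 := hall z
      simp only [f, LinearMap.sub_apply, LinearMap.smul_apply, smul_eq_mul] at h1
      have h2 := (hNy ht).ne
      field_simp
      linarith
    subst this
    rfl
  obtain ⟨ε, hε1, hε2⟩ := ((((Finset.eventually_all D.T).2 fun t ht =>
    (D.root t).eventually_pos u (root_x₀_pos ht))).and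
    (Filter.eventually_all.2 fun i => (f i).eventually_ne_zero D.x₀ (hu i))).exists
  set c := D.x₀ + ε • u
  -- Time at which the segment from `c` to `y` crosses the hyperplane of `t`. The earliest crossing
  -- point lies on a single hyperplane and on the positive side of all others, so this hyperplane is
  -- a wall.
  let τ : (E ≃ₗ[ℝ] E) → ℝ := fun t => D.root t c / (D.root t c - D.root t y)
  obtain ⟨s, hsN, hmin⟩ := N.exists_min_image τ hNne
  have hsc := hε1 s (hNT hsN)
  have hsy := hNy hsN
  have hds : 0 < D.root s c - D.root s y := by linarith
  have hτ0 : 0 < τ s := div_pos hsc hds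
  have hτ1 : τ s < 1 := by rw [div_lt_one hds]; linarith
  have hp : ∀ t, D.root t (c + τ s • (y - c)) =
      D.root t c - τ s * (D.root t c - D.root t y) := by
    intro t; simp only [map_add, map_smul, map_sub, smul_eq_mul]; ring
  refine ⟨s, mem_S_iff_exists.2 ⟨hNT hsN, c + τ s • (y - c), ?_, fun t ht hne => ?_⟩, hsy⟩
  · rw [hp]; simp only [τ]; field_simp; ring
  · rw [hp]
    have htc := hε1 t ht
    by_cases hty : D.root t y < 0
    · have htN : t ∈ N := Finset.mem_filter.2 ⟨ht, hty⟩
      have hdt : 0 < D.root t c - D.root t y := by linarith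
      have hlt : τ s < τ t := by
        refine lt_of_le_of_ne (hmin t htN) fun heq => ?_
        refine hε2 ⟨⟨⟨t, htN⟩, ⟨s, hsN⟩⟩, fun h => hne (congrArg Subtype.val h)⟩ ?_
        simp only [τ] at heq
        rw [div_eq_div_iff hds.ne' hdt.ne'] at heq
        simp only [f, LinearMap.sub_apply, LinearMap.smul_apply, smul_eq_mul]
        linarith
      have : τ s * (D.root t c - D.root t y) < D.root t c := (lt_div_iff₀ hdt).1 hlt
      linarith
    · push Not at hty
      nlinarith [mul_nonneg hτ0.le hty]

open Classical in
variable (D) in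
/-- The reflections whose hyperplane separates the point `y` from the chamber. -/
noncomputable def negRoots (y : E) : Finset (E ≃ₗ[ℝ] E) := D.T.filter fun t => D.root t y < 0

theorem mem_negRoots {t : E ≃ₗ[ℝ] E} {y : E} :
    t ∈ D.negRoots y ↔ t ∈ D.T ∧ D.root t y < 0 := by
  simp [negRoots]

theorem negRoots_eq_empty_iff {y : E} : D.negRoots y = ∅ ↔ D.Dominant y := by
  simp [negRoots, Finset.filter_eq_empty_iff, Dominant]

/-- Conjugation by `s` permutes the reflections other than `s` and respects their positive sides, so
only `s` itself leaves the set. -/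
theorem card_negRoots_simple_apply {s : E ≃ₗ[ℝ] E} (hs : s ∈ D.S) {y : E}
    (h : D.root s y < 0) : (D.negRoots (s y)).card + 1 = (D.negRoots y).card := by
  classical
  have hsT := mem_T_of_mem_S hs
  have hsN := W_le_normalizer (mem_W_of_mem_S hs)
  have hsy : s ∈ D.negRoots y := mem_negRoots.2 ⟨hsT, h⟩
  rw [← Finset.card_erase_add_one hsy, add_left_inj]
  have hinvol : ∀ t, s⁻¹ * (s⁻¹ * t * s) * s = t := by
    intro t
    rw [inv_of_mem_T hsT]
    calc s * (s * t * s) * s = (s * s) * t * (s * s) := by group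
      _ = t := by rw [mul_self_of_mem_T hsT]; group
  have hne : ∀ {t}, t ≠ s → s⁻¹ * t * s ≠ s := by
    intro t hts heq
    apply hts
    rw [← hinvol t, heq]; simp
  refine Finset.card_nbij' (fun t => s⁻¹ * t * s) (fun t => s⁻¹ * t * s) ?_ ?_
    (fun t _ => hinvol t) (fun t _ => hinvol t)
  · intro t ht
    obtain ⟨htT, hty⟩ := mem_negRoots.1 (Finset.mem_coe.1 ht)
    have hts : t ≠ s := by
      rintro rfl
      rw [root_self_apply htT] at hty
      linarith
    obtain ⟨c, hc, hr⟩ := exists_root_simple_apply hs htT hts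
    rw [hr] at hty
    exact Finset.mem_coe.2 (Finset.mem_erase.2 ⟨hne hts, mem_negRoots.2 ⟨conj_mem_T' hsN htT,
      neg_of_mul_neg_right hty hc.le⟩⟩)
  · intro t ht
    obtain ⟨hts, ht⟩ := Finset.mem_erase.1 (Finset.mem_coe.1 ht)
    obtain ⟨htT, hty⟩ := mem_negRoots.1 ht
    obtain ⟨c, hc, hr⟩ := exists_root_simple_apply hs (conj_mem_T' hsN htT) (hne hts)
    rw [hinvol] at hr
    refine Finset.mem_coe.2 (mem_negRoots.2 ⟨conj_mem_T' hsN htT, ?_⟩)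
    rw [hr]
    exact mul_neg_of_pos_of_neg hc hty

/-- Every point is conjugate to a point of the closure of the chamber. -/
theorem exists_dominant_apply (y : E) : ∃ g ∈ Subgroup.closure D.S, D.Dominant (g y) := by
  induction hn : (D.negRoots y).card generalizing y with
  | zero =>
    exact ⟨1, one_mem _, negRoots_eq_empty_iff.1 (Finset.card_eq_zero.1 hn)⟩
  | succ n ih =>
    obtain ⟨t, ht⟩ := Finset.card_pos.1 (by omega : 0 < (D.negRoots y).card)
    obtain ⟨s, hs, hsy⟩ := exists_simple_neg ⟨t, mem_negRoots.1 ht⟩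
    have := card_negRoots_simple_apply hs hsy
    obtain ⟨g, hg, hgy⟩ := ih (s y) (by omega)
    exact ⟨g * s, mul_mem hg (Subgroup.subset_closure hs), hgy⟩

theorem closure_S_le : Subgroup.closure D.S ≤ D.W :=
  (Subgroup.closure_le _).2 fun _ => mem_W_of_mem_S

theorem closure_le_W {I : Set (E ≃ₗ[ℝ] E)} (hI : I ⊆ D.S) : Subgroup.closure I ≤ D.W :=
  (Subgroup.closure_mono hI).trans closure_S_le

-- Take `p` on the hyperplane of `t` and on no other. An element `g` of the subgroup generated by
-- `S` brings `p` into the closure of the chamber, where the hyperplane of `g t g⁻¹` is a wall.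
variable (D) in
theorem closure_S : Subgroup.closure D.S = D.W := by
  refine le_antisymm closure_S_le ?_
  conv_lhs => rw [← D.closure_reflections]
  rw [Subgroup.closure_le]
  intro t ht
  replace ht : t ∈ D.T := D.mem_T.2 ht
  classical
  obtain ⟨p, hp, hp'⟩ := Module.Dual.exists_forall_mem_ne_zero_of_forall_exists
    (LinearMap.ker (D.root t)) (fun i : {t' // t' ∈ D.T.erase t} => D.root i.1) (by
      rintro ⟨t', ht'⟩
      obtain ⟨hne, ht'⟩ := Finset.mem_erase.1 ht'
      obtain ⟨y, hy, hy'⟩ := exists_root_eq_zero_ne_zero ht ht' hne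
      exact ⟨y, LinearMap.mem_ker.2 hy, hy'⟩)
  rw [LinearMap.mem_ker] at hp
  obtain ⟨g, hg, hgp⟩ := D.exists_dominant_apply p
  have hgN := W_le_normalizer (closure_S_le hg)
  have hmem : g * t * g⁻¹ ∈ D.S := by
    refine mem_S_iff_exists.2 ⟨conj_mem_T hgN ht, g p, ?_, fun r hr hne => ?_⟩
    · rw [root_eq_zero_iff (conj_mem_T hgN ht)]
      change g (t (g⁻¹ (g p))) = _
      rw [LinearEquiv.inv_apply_apply, (root_eq_zero_iff ht).1 hp]
    · refine lt_of_le_of_ne (hgp r hr) (Ne.symm ?_)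
      obtain ⟨c, hc, h⟩ := exists_root_apply hgN hr
      rw [h]
      refine mul_ne_zero hc (hp' ⟨_, Finset.mem_erase.2 ⟨fun heq => hne ?_, conj_mem_T' hgN hr⟩⟩)
      rw [← heq]; group
  have h2 := mul_mem (mul_mem (inv_mem hg) (Subgroup.subset_closure hmem)) hg
  have e : g⁻¹ * (g * t * g⁻¹) * g = t := by group
  rwa [e] at h2

/-! ### Coxeter combinatorics -/

variable (D) in
/-- The number of hyperplanes separating the chamber from its image by `g`. -/
noncomputable def numInv (g : E ≃ₗ[ℝ] E) : ℕ := (D.negRoots (g D.x₀)).card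

theorem numInv_simple_mul_of_neg {s g : E ≃ₗ[ℝ] E} (hs : s ∈ D.S) (h : D.root s (g D.x₀) < 0) :
    D.numInv (s * g) + 1 = D.numInv g := card_negRoots_simple_apply hs h

theorem numInv_simple_mul_of_pos {s g : E ≃ₗ[ℝ] E} (hs : s ∈ D.S) (h : 0 < D.root s (g D.x₀)) :
    D.numInv (s * g) = D.numInv g + 1 := by
  have hsT := mem_T_of_mem_S hs
  have := numInv_simple_mul_of_neg (g := s * g) hs (by
    change D.root s (s (g D.x₀)) < 0
    rw [root_self_apply hsT]; linarith)
  rw [← mul_assoc, mul_self_of_mem_T hsT, one_mul] at this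
  exact this.symm

theorem root_W_ne_zero {t w : E ≃ₗ[ℝ] E} (ht : t ∈ D.T) (hw : w ∈ D.W) :
    D.root t (w D.x₀) ≠ 0 := root_apply_ne_zero (W_le_normalizer hw) ht

theorem numInv_simple_mul_lt_iff {s w : E ≃ₗ[ℝ] E} (hs : s ∈ D.S) (hw : w ∈ D.W) :
    D.numInv (s * w) < D.numInv w ↔ D.root s (w D.x₀) < 0 := by
  rcases lt_or_gt_of_ne (root_W_ne_zero (mem_T_of_mem_S hs) hw) with h | h
  · have := numInv_simple_mul_of_neg hs h
    simp only [h, iff_true]; omega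
  · have := numInv_simple_mul_of_pos hs h
    simp only [h.not_gt, iff_false]; omega

theorem numInv_lt_simple_mul_iff {s w : E ≃ₗ[ℝ] E} (hs : s ∈ D.S) (hw : w ∈ D.W) :
    D.numInv w < D.numInv (s * w) ↔ 0 < D.root s (w D.x₀) := by
  rcases lt_or_gt_of_ne (root_W_ne_zero (mem_T_of_mem_S hs) hw) with h | h
  · have := numInv_simple_mul_of_neg hs h
    simp only [h.not_gt, iff_false]; omega
  · have := numInv_simple_mul_of_pos hs h
    simp only [h, iff_true]; omega

variable (D) in
theorem numInv_one : D.numInv 1 = 0 :=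
  Finset.card_eq_zero.2 (negRoots_eq_empty_iff.2 fun _ ht => (root_x₀_pos ht).le)

/-- The only hyperplane between the adjacent chambers `uC` and `usC` is that of `u s u⁻¹`. -/
theorem mul_eq_mul_of_sign_change {t s u : E ≃ₗ[ℝ] E} (ht : t ∈ D.T) (hs : s ∈ D.S)
    (hu : u ∈ D.W) (h : 0 < D.root t (u D.x₀)) (h' : D.root t ((u * s) D.x₀) < 0) :
    t * u = u * s := by
  have huN := W_le_normalizer hu
  have ht' := conj_mem_T' huN ht
  obtain ⟨c, hc, hr⟩ := exists_root_apply_pos huN ht (root_x₀_pos ht') h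
  by_cases heq : u⁻¹ * t * u = s
  · rw [← heq]; group
  · obtain ⟨c', hc', hr'⟩ := exists_root_simple_apply hs ht' heq
    have h2 := root_x₀_pos (conj_mem_T' (W_le_normalizer (mem_W_of_mem_S hs)) ht')
    change D.root t (u (s D.x₀)) < 0 at h'
    rw [hr, hr'] at h'
    exact absurd h' (mul_pos hc (mul_pos hc' h2)).not_gt

/-- The product in the linear group of a word in the simple reflections. -/
def wordProd (L : List D.S) : E ≃ₗ[ℝ] E := (L.map (fun s : D.S => (s : E ≃ₗ[ℝ] E))).prod

theorem prod_map_coe_eq_wordProd (L : List D.S) :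
    (L.map (fun s => (s : E ≃ₗ[ℝ] E))).prod = wordProd L := by
  rw [wordProd]
  congr 1
  induction L with
  | nil => rfl
  | cons s L ih => simp

@[simp] theorem wordProd_nil : wordProd ([] : List D.S) = 1 := rfl

@[simp] theorem wordProd_cons (s : D.S) (L : List D.S) :
    wordProd (s :: L) = s * wordProd L := by simp [wordProd]

@[simp] theorem wordProd_append (L M : List D.S) :
    wordProd (L ++ M) = wordProd L * wordProd M := by simp [wordProd]

theorem wordProd_mem (L : List D.S) : wordProd L ∈ D.W := by
  induction L with
  | nil => exact one_mem _
  | cons s L ih => rw [wordProd_cons]; exact mul_mem (mem_W_of_mem_S s.2) ih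

/-- The exchange condition. -/
theorem exists_word_exchange {t : E ≃ₗ[ℝ] E} (ht : t ∈ D.T) (L : List D.S)
    (h : D.root t (wordProd L D.x₀) < 0) :
    ∃ M : List D.S, M.length + 1 = L.length ∧ wordProd M = t * wordProd L := by
  induction L using List.reverseRecOn with
  | nil => exact absurd h (root_x₀_pos ht).not_gt
  | append_singleton L s ih =>
    rcases lt_or_gt_of_ne (root_W_ne_zero ht (wordProd_mem L)) with h' | h'
    · obtain ⟨M, hM, hM'⟩ := ih h'
      exact ⟨M ++ [s], by simp [hM], by simp [hM', mul_assoc]⟩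
    -- The hyperplane of `t` is crossed at the last letter, so multiplying by `t` deletes that
    -- letter.
    · have h1 := mul_eq_mul_of_sign_change (u := wordProd L) ht s.2 (wordProd_mem L) h'
        (by simpa using h)
      refine ⟨L, by simp, ?_⟩
      rw [wordProd_append, ← mul_assoc, h1]
      simp [mul_assoc, mul_self_of_mem_T (mem_T_of_mem_S s.2)]

theorem wordProd_reverse (L : List D.S) : wordProd L.reverse = (wordProd L)⁻¹ := by
  induction L with
  | nil => simp
  | cons s L ih => simp [ih, inv_of_mem_T (mem_T_of_mem_S s.2)]

theorem exists_wordProd_eq {w : E ≃ₗ[ℝ] E} (hw : w ∈ D.W) : ∃ L : List D.S, wordProd L = w := by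
  rw [← D.closure_S] at hw
  induction hw using Subgroup.closure_induction with
  | mem s hs => exact ⟨[⟨s, hs⟩], by simp⟩
  | one => exact ⟨[], rfl⟩
  | mul a b _ _ iha ihb =>
    obtain ⟨L, rfl⟩ := iha
    obtain ⟨M, rfl⟩ := ihb
    exact ⟨L ++ M, by simp⟩
  | inv a _ iha =>
    obtain ⟨L, rfl⟩ := iha
    exact ⟨L.reverse, wordProd_reverse L⟩

theorem wordLength_le (L : List D.S) : wordLength D.S (wordProd L) ≤ L.length :=
  Nat.sInf_le ⟨L, prod_map_coe_eq_wordProd L, rfl⟩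

theorem exists_reduced_word {w : E ≃ₗ[ℝ] E} (hw : w ∈ D.W) :
    ∃ L : List D.S, wordProd L = w ∧ L.length = wordLength D.S w := by
  obtain ⟨L, hL⟩ := exists_wordProd_eq hw
  obtain ⟨M, hM, hM'⟩ := Nat.sInf_mem (s := {n | ∃ L : List D.S,
    (L.map (fun s => (s : E ≃ₗ[ℝ] E))).prod = w ∧ L.length = n})
    ⟨_, L, (prod_map_coe_eq_wordProd L).trans hL, rfl⟩
  exact ⟨M, (prod_map_coe_eq_wordProd M).symm.trans hM, hM'⟩

/-- If a reduced word of `u` began with `s`, dominance would put the rest of the word on the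
negative side of `s`, and exchange would give a shorter word for `u`. -/
theorem eq_one_of_dominant {u : E ≃ₗ[ℝ] E} (hu : u ∈ D.W) (h : D.Dominant (u D.x₀)) : u = 1 := by
  obtain ⟨L, rfl, hL⟩ := exists_reduced_word hu
  cases L with
  | nil => rfl
  | cons s L =>
    exfalso
    have hsT := mem_T_of_mem_S s.2
    have h1 := lt_of_le_of_ne (h s hsT) (root_W_ne_zero hsT hu).symm
    rw [wordProd_cons] at h1
    change 0 < D.root s ((s : E ≃ₗ[ℝ] E) (wordProd L D.x₀)) at h1
    rw [root_self_apply hsT] at h1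
    obtain ⟨M, hM, hM'⟩ := exists_word_exchange hsT L (by linarith)
    rw [wordProd_cons, ← hM'] at hL
    have := wordLength_le M
    simp only [List.length_cons] at hL
    omega

theorem eq_one_of_numInv_eq_zero {u : E ≃ₗ[ℝ] E} (hu : u ∈ D.W) (h : D.numInv u = 0) : u = 1 :=
  eq_one_of_dominant hu (negRoots_eq_empty_iff.1 (Finset.card_eq_zero.1 h))

theorem exists_descent {w : E ≃ₗ[ℝ] E} (hw : w ∈ D.W) (h : w ≠ 1) :
    ∃ s ∈ D.S, D.root s (w D.x₀) < 0 := by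
  apply exists_simple_neg
  by_contra! hall
  exact h (eq_one_of_dominant hw hall)

theorem numInv_wordProd_le (L : List D.S) : D.numInv (wordProd L) ≤ L.length := by
  induction L with
  | nil => simp [numInv_one]
  | cons s L ih =>
    rw [wordProd_cons, List.length_cons]
    rcases lt_or_gt_of_ne (root_W_ne_zero (mem_T_of_mem_S s.2) (wordProd_mem L)) with h | h
    · have := numInv_simple_mul_of_neg s.2 h
      omega
    · have := numInv_simple_mul_of_pos s.2 h
      omega

theorem exists_word_numInv {w : E ≃ₗ[ℝ] E} (hw : w ∈ D.W) :
    ∃ L : List D.S, wordProd L = w ∧ L.length = D.numInv w := by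
  induction hn : D.numInv w generalizing w with
  | zero => exact ⟨[], (eq_one_of_numInv_eq_zero hw hn).symm, rfl⟩
  | succ n ih =>
    obtain ⟨s, hs, h⟩ := exists_descent hw (by rintro rfl; simp [numInv_one] at hn)
    have := numInv_simple_mul_of_neg hs h
    obtain ⟨L, hL, hL'⟩ := ih (w := s * w) (mul_mem (mem_W_of_mem_S hs) hw) (by omega)
    refine ⟨⟨s, hs⟩ :: L, ?_, by simp [hL']⟩
    rw [wordProd_cons, hL, ← mul_assoc, mul_self_of_mem_T (mem_T_of_mem_S hs), one_mul]

/-- The length of `w` is the number of hyperplanes separating the chamber from its image. -/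
theorem len_eq_numInv {w : E ≃ₗ[ℝ] E} (hw : w ∈ D.W) : D.len w = D.numInv w := by
  apply le_antisymm
  · obtain ⟨L, rfl, hL⟩ := exists_word_numInv hw
    exact (wordLength_le L).trans hL.le
  · obtain ⟨L, rfl, hL⟩ := exists_reduced_word hw
    exact (numInv_wordProd_le L).trans hL.le

theorem numInv_mul_le {u v : E ≃ₗ[ℝ] E} (hu : u ∈ D.W) (hv : v ∈ D.W) :
    D.numInv (u * v) ≤ D.numInv u + D.numInv v := by
  obtain ⟨L, rfl, hL⟩ := exists_word_numInv hu
  obtain ⟨M, rfl, hM⟩ := exists_word_numInv hv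
  have := numInv_wordProd_le (L ++ M)
  rw [wordProd_append, List.length_append] at this
  omega

end RealReflectionCoset

theorem mul_neg_iff_neg_right {c x : ℝ} (hc : 0 < c) : c * x < 0 ↔ x < 0 :=
  ⟨fun h => neg_of_mul_neg_right h hc.le, mul_neg_of_pos_of_neg hc⟩

namespace RealReflectionCoset

variable {E : Type*} [AddCommGroup E] [Module ℝ E] {D : RealReflectionCoset E}

/-! ### Inversion sets -/

theorem card_filter_conj {g : E ≃ₗ[ℝ] E}
    (hg : g ∈ Subgroup.normalizer (D.W : Set (E ≃ₗ[ℝ] E))) {P Q : (E ≃ₗ[ℝ] E) → Prop}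
    [DecidablePred P] [DecidablePred Q] (h : ∀ t ∈ D.T, P t ↔ Q (g⁻¹ * t * g)) : (D.T.filter P).card = (D.T.filter Q).card := by
  have e1 : ∀ t, g * (g⁻¹ * t * g) * g⁻¹ = t := fun t => by group
  have e2 : ∀ t, g⁻¹ * (g * t * g⁻¹) * g = t := fun t => by group
  refine Finset.card_nbij' (fun t => g⁻¹ * t * g) (fun t => g * t * g⁻¹) ?_ ?_
    (fun t _ => e1 t) (fun t _ => e2 t)
  · intro t ht
    obtain ⟨ht, hP⟩ := Finset.mem_filter.1 (Finset.mem_coe.1 ht)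
    exact Finset.mem_coe.2 (Finset.mem_filter.2 ⟨conj_mem_T' hg ht, (h t ht).1 hP⟩)
  · intro t ht
    obtain ⟨ht, hQ⟩ := Finset.mem_filter.1 (Finset.mem_coe.1 ht)
    refine Finset.mem_coe.2 (Finset.mem_filter.2 ⟨conj_mem_T hg ht, (h _ (conj_mem_T hg ht)).2 ?_⟩)
    rwa [e2]

theorem root_pos_or_neg {t w : E ≃ₗ[ℝ] E} (ht : t ∈ D.T) (hw : w ∈ D.W) :
    0 < D.root t (w D.x₀) ∨ D.root t (w D.x₀) < 0 :=
  (lt_or_gt_of_ne (root_W_ne_zero ht hw)).symm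

/-- Needed because `φ` preserves the chamber but need not fix `x₀`. -/
theorem negRoots_apply_of_mem_C {g : E ≃ₗ[ℝ] E}
    (hg : g ∈ Subgroup.normalizer (D.W : Set (E ≃ₗ[ℝ] E))) {y : E} (hy : y ∈ D.C) :
    D.negRoots (g y) = D.negRoots (g D.x₀) := by
  ext t
  rw [mem_negRoots, mem_negRoots]
  refine and_congr_right fun ht => ?_
  obtain ⟨c, hc, h⟩ := exists_root_apply hg ht
  have h1 := mem_C_iff.1 hy _ (conj_mem_T' hg ht)
  have h2 := root_x₀_pos (conj_mem_T' hg ht)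
  rw [h, h, mul_comm c, mul_comm c, mul_neg_iff_neg_right h1, mul_neg_iff_neg_right h2]

/-- Geometric criterion for additivity of lengths: when the inversions of `u` remain inversions of
`u * v`, the other inversions of `u * v` are the conjugates by `u` of those of `v`. -/
theorem numInv_mul {u v : E ≃ₗ[ℝ] E} (hu : u ∈ D.W)
    (h : ∀ t ∈ D.T, D.root t (u D.x₀) < 0 → D.root t ((u * v) D.x₀) < 0) :
    D.numInv (u * v) = D.numInv u + D.numInv v := by
  classical
  have hsub : D.negRoots (u D.x₀) ⊆ D.negRoots ((u * v) D.x₀) := by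
    intro t ht
    rw [mem_negRoots] at ht ⊢
    exact ⟨ht.1, h t ht.1 ht.2⟩
  have huN := W_le_normalizer hu
  have h1 : (D.negRoots ((u * v) D.x₀) \ D.negRoots (u D.x₀)).card = D.numInv v := by
    have e : D.negRoots ((u * v) D.x₀) \ D.negRoots (u D.x₀) =
        D.T.filter (fun t => D.root t ((u * v) D.x₀) < 0 ∧ ¬ D.root t (u D.x₀) < 0) := by
      ext t
      simp only [Finset.mem_sdiff, mem_negRoots, Finset.mem_filter]
      tauto
    rw [e, numInv, negRoots]
    refine (card_filter_conj huN (Q := fun t => D.root t (v D.x₀) < 0) fun t ht => ?_).trans ?_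
    · have h0 := root_x₀_pos (conj_mem_T' huN ht)
      rcases root_pos_or_neg ht hu with hp | hn
      · obtain ⟨c, hc, hr⟩ := exists_root_apply_pos huN ht h0 hp
        simp only [hp.not_gt, not_false_eq_true, and_true]
        change D.root t (u (v D.x₀)) < 0 ↔ _
        rw [hr, mul_neg_iff_neg_right hc]
      · obtain ⟨c, hc, hr⟩ := exists_root_apply_neg huN ht h0 hn
        have h2 := h t ht hn
        change D.root t (u (v D.x₀)) < 0 at h2
        rw [hr] at h2
        simp only [hn, not_true_eq_false, and_false, false_iff, not_lt]
        exact (pos_of_mul_neg_right h2 hc.le).le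
    · congr
  have h2 := Finset.card_sdiff_add_card_eq_card hsub
  rw [h1] at h2
  rw [numInv, ← h2, add_comm]
  rfl

theorem numInv_inv {u : E ≃ₗ[ℝ] E} (hu : u ∈ D.W) : D.numInv u⁻¹ = D.numInv u := by
  have key : ∀ {v : E ≃ₗ[ℝ] E}, v ∈ D.W → D.numInv v⁻¹ ≤ D.numInv v := by
    intro v hv
    obtain ⟨L, rfl, hL⟩ := exists_word_numInv hv
    rw [← wordProd_reverse, ← hL, ← List.length_reverse]
    exact numInv_wordProd_le _
  refine le_antisymm (key hu) ?_
  simpa using key (inv_mem hu)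

/-- No hyperplane separates `uC` from `vC`, so `u⁻¹ v` sends `x₀` into the closure of the chamber.
-/
theorem eq_of_neg_iff_neg {u v : E ≃ₗ[ℝ] E} (hu : u ∈ D.W) (hv : v ∈ D.W)
    (h : ∀ t ∈ D.T, D.root t (u D.x₀) < 0 ↔ D.root t (v D.x₀) < 0) : u = v := by
  have hN := W_le_normalizer (inv_mem hu)
  refine inv_mul_eq_one.1 (eq_one_of_dominant (mul_mem (inv_mem hu) hv) fun t ht => ?_)
  obtain ⟨c, hc, hr⟩ := exists_root_apply hN ht
  have h0 := root_x₀_pos ht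
  have h1 := conj_mem_T' hN ht
  change 0 ≤ D.root t (u⁻¹ (v D.x₀))
  rw [← LinearEquiv.inv_apply_apply u D.x₀, hr] at h0
  rw [hr]
  have h2 := h _ h1
  rcases root_pos_or_neg h1 hv with hv' | hv' <;> rcases root_pos_or_neg h1 hu with hu' | hu'
  · exact mul_nonneg (pos_of_mul_pos_left h0 hu'.le).le hv'.le
  · exact absurd (h2.1 hu') hv'.not_gt
  · exact absurd (h2.2 hv') hu'.not_gt
  · exact mul_nonneg_of_nonpos_of_nonpos (neg_of_mul_pos_left h0 hu'.le).le hv'.le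

theorem mem_S_of_numInv_le_one {t : E ≃ₗ[ℝ] E} (ht : t ∈ D.T) (h : D.numInv t ≤ 1) : t ∈ D.S := by
  have htW := (D.mem_T.1 ht).1
  have hne : t ≠ 1 := by
    rintro rfl
    exact D.x₀_ne ht rfl
  obtain ⟨s, hs, hst⟩ := exists_descent htW hne
  have h1 := numInv_simple_mul_of_neg hs hst
  have h2 := eq_one_of_numInv_eq_zero (mul_mem (mem_W_of_mem_S hs) htW) (by omega)
  rw [mul_eq_one_iff_inv_eq, inv_of_mem_T (mem_T_of_mem_S hs)] at h2
  exact h2 ▸ hs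

theorem numInv_simple {s : E ≃ₗ[ℝ] E} (hs : s ∈ D.S) : D.numInv s = 1 := by
  have := numInv_simple_mul_of_pos (g := 1) hs (root_x₀_pos (mem_T_of_mem_S hs))
  rwa [mul_one, numInv_one] at this

/-! ### Reduced words and canonical lifts -/

/-- The alternating word `a b a ⋯` with `n` letters. -/
def altWord {α : Type*} (a b : α) : ℕ → List α
  | 0 => []
  | n + 1 => a :: altWord b a n

theorem length_altWord {α : Type*} (a b : α) (n : ℕ) : (altWord a b n).length = n := by
  induction n generalizing a b with
  | zero => rfl
  | succ n ih => simp [altWord, ih]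

theorem prod_map_altWord {α M : Type*} [Monoid M] (f : α → M) (a b : α) (n : ℕ) :
    ((altWord a b n).map f).prod = altProd (f a) (f b) n := by
  induction n generalizing a b with
  | zero => rfl
  | succ n ih => simp [altWord, altProd, ih]

theorem wordProd_altWord (s t : D.S) (n : ℕ) :
    wordProd (altWord s t n) = altProd (s : E ≃ₗ[ℝ] E) t n  := by
  rw [wordProd, prod_map_altWord]

theorem altProd_succ_eq_mul {M : Type*} [Monoid M] (a b : M) (n : ℕ) :
    ∃ c, (c = a ∨ c = b) ∧ altProd a b (n + 1) = altProd a b n * c := by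
  induction n generalizing a b with
  | zero => exact ⟨a, Or.inl rfl, by simp [altProd]⟩
  | succ n ih =>
    obtain ⟨c, hc, h⟩ := ih b a
    exact ⟨c, hc.symm, by
      rw [show altProd a b (n + 1 + 1) = a * altProd b a (n + 1) from rfl, h, ← mul_assoc]; rfl⟩

/-- Relates the order of `s t` to the braid relation: the power is trivial exactly when the two
alternating products agree. -/
theorem mul_pow_eq_altProd {G : Type*} [Group G] {s t : G} (hs : s * s = 1) (ht : t * t = 1)
    (n : ℕ) : (s * t) ^ n = altProd s t n * (altProd t s n)⁻¹ := by
  induction n generalizing s t with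
  | zero => simp [altProd]
  | succ n ih =>
    have ht' : t⁻¹ = t := inv_eq_of_mul_eq_one_left ht
    have h1 := ih ht hs
    calc (s * t) ^ (n + 1) = s * (t * s) ^ n * t := by
          rw [pow_succ, ← mul_assoc, mul_pow_mul]
      _ = _ := by rw [h1]; simp only [altProd, mul_inv_rev, ht']; group

theorem altProd_mem {G : Type*} [Group G] {H : Subgroup G} {a b : G} (ha : a ∈ H) (hb : b ∈ H)
    (n : ℕ) : altProd a b n ∈ H := by
  induction n generalizing a b with
  | zero => exact one_mem _
  | succ n ih => exact mul_mem ha (ih hb ha)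

/-- The letter at which the hyperplane of `b` is first crossed yields an equality of alternating
products, hence forces the order of `a b` to be at most `k`. -/
theorem exists_altProd_eq_of_neg {a b : E ≃ₗ[ℝ] E} (ha : a ∈ D.S) (hb : b ∈ D.S) (k : ℕ)
    (h : D.root b (altProd a b k D.x₀) < 0) :
    ∃ j < k, altProd b a (j + 1) = altProd a b (j + 1) := by
  induction k with
  | zero => exact absurd h (root_x₀_pos (mem_T_of_mem_S hb)).not_gt
  | succ k ih =>
    have hm := altProd_mem (mem_W_of_mem_S ha) (mem_W_of_mem_S hb) k
    rcases root_pos_or_neg (mem_T_of_mem_S hb) hm with h' | h'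
    · obtain ⟨c, hc, hc'⟩ := altProd_succ_eq_mul a b k
      have hcS : c ∈ D.S := by rcases hc with rfl | rfl <;> assumption
      rw [hc'] at h
      exact ⟨k, k.lt_succ_self, by
        rw [hc', ← mul_eq_mul_of_sign_change (mem_T_of_mem_S hb) hcS hm h' h]; rfl⟩
    · obtain ⟨j, hj, hj'⟩ := ih h'
      exact ⟨j, by omega, hj'⟩

theorem numInv_altProd_le {a b : E ≃ₗ[ℝ] E} (ha : a ∈ D.S) (hb : b ∈ D.S) (k : ℕ) :
    D.numInv (altProd a b k) ≤ k := by
  have := numInv_wordProd_le (altWord (⟨a, ha⟩ : D.S) ⟨b, hb⟩ k)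
  rwa [wordProd_altWord, length_altWord] at this

theorem orderOf_dvd_of_altProd_eq {a b : E ≃ₗ[ℝ] E} (ha : a ∈ D.S) (hb : b ∈ D.S) {k : ℕ}
    (h : altProd a b k = altProd b a k) : orderOf (a * b) ∣ k := by
  rw [orderOf_dvd_iff_pow_eq_one, mul_pow_eq_altProd (mul_self_of_mem_T (mem_T_of_mem_S ha))
    (mul_self_of_mem_T (mem_T_of_mem_S hb)), h, mul_inv_cancel]

theorem altProd_orderOf {a b : E ≃ₗ[ℝ] E} (ha : a ∈ D.S) (hb : b ∈ D.S) :
    altProd a b (orderOf (a * b)) = altProd b a (orderOf (a * b)) := by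
  rw [← mul_inv_eq_one, ← mul_pow_eq_altProd (mul_self_of_mem_T (mem_T_of_mem_S ha))
    (mul_self_of_mem_T (mem_T_of_mem_S hb)), pow_orderOf_eq_one]

theorem orderOf_mul_comm_of_mem_S {a b : E ≃ₗ[ℝ] E} (ha : a ∈ D.S) (hb : b ∈ D.S) :
    orderOf (b * a) = orderOf (a * b) := by
  rw [← orderOf_inv, mul_inv_rev, inv_of_mem_T (mem_T_of_mem_S ha),
    inv_of_mem_T (mem_T_of_mem_S hb)]

/-- As `k` is below the order of `a b`, `b` is not a descent of the alternating prefix. The descent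
therefore comes from `w'`: exchange deletes one of its letters and puts `b` in front of the prefix.
-/
theorem exists_altProd_prefix_succ {a b w w' : E ≃ₗ[ℝ] E} (ha : a ∈ D.S) (hb : b ∈ D.S)
    (hw : D.root b (w D.x₀) < 0) {k : ℕ} (hk : k < orderOf (a * b)) (hw' : w' ∈ D.W)
    (h : w = altProd a b k * w') (hn : D.numInv w = k + D.numInv w') :
    ∃ w'' ∈ D.W, w = altProd b a (k + 1) * w'' ∧ D.numInv w = k + 1 + D.numInv w'' := by
  have hbT := mem_T_of_mem_S hb
  have hu := altProd_mem (mem_W_of_mem_S ha) (mem_W_of_mem_S hb) k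
  have huN := W_le_normalizer hu
  set u := altProd a b k with hu_def
  rcases root_pos_or_neg hbT hu with h' | h'
  · have ht' := conj_mem_T' huN hbT
    obtain ⟨c, hc, hr⟩ := exists_root_apply_pos huN hbT (root_x₀_pos ht') h'
    obtain ⟨L, rfl, hL⟩ := exists_word_numInv hw'
    obtain ⟨M, hM, hM'⟩ := exists_word_exchange ht' L (by
      rw [h] at hw
      change D.root b (u (wordProd L D.x₀)) < 0 at hw
      rw [hr] at hw
      exact neg_of_mul_neg_right hw hc.le)
    have hw2 : w = altProd b a (k + 1) * wordProd M := by
      rw [altProd, hM', ← hu_def, h]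
      calc u * wordProd L = (b * b) * (u * wordProd L) := by
            rw [mul_self_of_mem_T hbT, one_mul]
        _ = _ := by group
    refine ⟨wordProd M, wordProd_mem M, hw2, ?_⟩
    have h1 := numInv_mul_le (altProd_mem (mem_W_of_mem_S hb) (mem_W_of_mem_S ha) (k + 1))
      (wordProd_mem M)
    rw [← hw2] at h1
    have h2 := numInv_altProd_le hb ha (k + 1)
    have h3 := numInv_wordProd_le M
    omega
  · exfalso
    obtain ⟨j, hj, hj'⟩ := exists_altProd_eq_of_neg ha hb k h'
    have := Nat.le_of_dvd (by omega) (orderOf_dvd_of_altProd_eq ha hb hj'.symm)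
    omega

/-- If `s` and `t` are descents of `w`, then the longest element of `⟨s, t⟩` is a prefix of `w`. -/
theorem exists_altProd_prefix {s t w : E ≃ₗ[ℝ] E} (hs : s ∈ D.S) (ht : t ∈ D.S) (hw : w ∈ D.W)
    (hsw : D.root s (w D.x₀) < 0) (htw : D.root t (w D.x₀) < 0) :
    ∃ w' ∈ D.W, w = altProd s t (orderOf (s * t)) * w' ∧
      D.numInv w = orderOf (s * t) + D.numInv w' := by
  have key : ∀ k ≤ orderOf (s * t), ∃ w' ∈ D.W,
      (w = altProd s t k * w' ∨ w = altProd t s k * w') ∧ D.numInv w = k + D.numInv w' := by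
    intro k
    induction k with
    | zero => exact fun _ => ⟨w, hw, Or.inl (by simp [altProd]), by simp⟩
    | succ k ih =>
      intro hk
      obtain ⟨w', hw', h | h, hn⟩ := ih (by omega)
      · obtain ⟨w'', h1, h2, h3⟩ := exists_altProd_prefix_succ hs ht htw hk hw' h hn
        exact ⟨w'', h1, Or.inr h2, h3⟩
      · rw [← orderOf_mul_comm_of_mem_S hs ht] at hk
        obtain ⟨w'', h1, h2, h3⟩ := exists_altProd_prefix_succ ht hs hsw hk hw' h hn
        exact ⟨w'', h1, Or.inl h2, h3⟩
  obtain ⟨w', hw', h, hn⟩ := key _ le_rfl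
  rw [← altProd_orderOf hs ht, or_self] at h
  exact ⟨w', hw', h, hn⟩

/-- The product in the braid monoid of a word in the simple reflections. -/
def monProd (L : List D.S) : D.Bmon := (L.map (monGen D.S)).prod

@[simp] theorem monProd_nil : monProd ([] : List D.S) = 1 := rfl

@[simp] theorem monProd_cons (s : D.S) (L : List D.S) :
    monProd (s :: L) = monGen D.S s * monProd L := by simp [monProd]

@[simp] theorem monProd_append (L M : List D.S) :
    monProd (L ++ M) = monProd L * monProd M := by simp [monProd]

theorem monProd_altWord (s t : D.S) (n : ℕ) :
    monProd (altWord s t n) = altProd (monGen D.S s) (monGen D.S t) n := prod_map_altWord _ s t n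

/-- Matsumoto's theorem: two reduced words of the same element are equal in the braid monoid. -/
theorem monProd_eq_of_reduced (n : ℕ) : ∀ {L L' : List D.S}, L.length = n → L'.length = n →
    D.numInv (wordProd L) = n → wordProd L = wordProd L' → monProd L = monProd L' := by
  induction n with
  | zero =>
    intro L L' hL hL' _ _
    rw [List.length_eq_zero_iff.1 hL, List.length_eq_zero_iff.1 hL']
  | succ n ih =>
    intro L L' hL hL' hn heq
    obtain ⟨s, M, rfl⟩ := List.exists_cons_of_length_eq_add_one hL
    obtain ⟨t, M', rfl⟩ := List.exists_cons_of_length_eq_add_one hL'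
    simp only [List.length_cons, add_left_inj] at hL hL'
    have hcancel : ∀ (r : D.S) (K : List D.S), r * wordProd (r :: K) = wordProd K := by
      intro r K
      rw [wordProd_cons, ← mul_assoc, mul_self_of_mem_T (mem_T_of_mem_S r.2), one_mul]
    have hdesc : ∀ (r : D.S) (K : List D.S), K.length = n →
        D.numInv (wordProd (r :: K)) = n + 1 →
        D.root r (wordProd (r :: K) D.x₀) < 0 ∧ D.numInv (wordProd K) = n := by
      intro r K hK hr
      have h1 := numInv_wordProd_le K
      have h2 := (numInv_simple_mul_lt_iff r.2 (wordProd_mem (r :: K))).1 (by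
        rw [hcancel]; omega)
      have h3 := numInv_simple_mul_of_neg r.2 h2
      rw [hcancel] at h3
      exact ⟨h2, by omega⟩
    obtain ⟨hs, hM⟩ := hdesc s M hL hn
    obtain ⟨ht, hM'⟩ := hdesc t M' hL' (heq ▸ hn)
    rw [monProd_cons, monProd_cons]
    rw [← heq] at ht
    -- Both words are compared with words starting with the longest element of `⟨s, t⟩`, written to
    -- begin with `s` or with `t`, followed by a common tail. The induction hypothesis applies after
    -- removing the first letter, and one braid relation links the two.
    obtain ⟨w', hw', hw, hnw⟩ := exists_altProd_prefix s.2 t.2 (wordProd_mem _) hs ht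
    obtain ⟨R, rfl, hR⟩ := exists_word_numInv hw'
    have hm : 0 < orderOf (s * t : E ≃ₗ[ℝ] E) := by
      have := D.finite_W
      have := orderOf_pos (⟨s * t, mul_mem (mem_W_of_mem_S s.2) (mem_W_of_mem_S t.2)⟩ : D.W)
      rwa [← Subgroup.orderOf_coe] at this
    obtain ⟨m, hm⟩ := Nat.exists_eq_succ_of_ne_zero hm.ne'
    have hgen := monGen_rel D.S s t
    have hw2 := hw
    rw [altProd_orderOf s.2 t.2] at hw2
    rw [hm] at hw hw2 hgen hnw
    have e1 : monProd M = monProd (altWord t s m ++ R) := by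
      refine ih hL ?_ hM ?_
      · rw [List.length_append, length_altWord]; omega
      · rw [wordProd_append, wordProd_altWord, ← hcancel s M, hw, altProd, ← mul_assoc,
          ← mul_assoc, mul_self_of_mem_T (mem_T_of_mem_S s.2), one_mul]
    have e2 : monProd M' = monProd (altWord s t m ++ R) := by
      refine ih hL' ?_ hM' ?_
      · rw [List.length_append, length_altWord]; omega
      · rw [wordProd_append, wordProd_altWord, ← hcancel t M', ← heq, hw2, altProd, ← mul_assoc,
          ← mul_assoc, mul_self_of_mem_T (mem_T_of_mem_S t.2), one_mul]
    rw [e1, e2, monProd_append, monProd_append, monProd_altWord, monProd_altWord, ← mul_assoc,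
      ← mul_assoc]
    exact congrArg (· * monProd R) hgen

theorem canonicalLift_wordProd {L : List D.S} (h : L.length = D.numInv (wordProd L)) :
    canonicalLift D.S (wordProd L) = monProd L := by
  have hlen := len_eq_numInv (wordProd_mem L)
  rw [len] at hlen
  have hex : ∃ b, IsCanonicalLift D.S b (wordProd L) := ⟨monProd L, L,
    prod_map_coe_eq_wordProd L, by rw [h, hlen], rfl⟩
  obtain ⟨M, hM, hM', hM''⟩ := Classical.epsilon_spec hex
  rw [prod_map_coe_eq_wordProd] at hM
  refine Eq.trans hM''.symm (monProd_eq_of_reduced _ rfl ?_ ?_ hM)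
  · rw [hM', h, hlen]
  · rw [hM', hlen]; exact congrArg _ hM

/-- Concatenated reduced words stay reduced when lengths add; the later identities between lifts are
reduced in this way to statements about lengths. -/
theorem canonicalLift_mul {u v : E ≃ₗ[ℝ] E} (hu : u ∈ D.W) (hv : v ∈ D.W)
    (h : D.numInv (u * v) = D.numInv u + D.numInv v) :
    canonicalLift D.S (u * v) = canonicalLift D.S u * canonicalLift D.S v := by
  obtain ⟨L, rfl, hL⟩ := exists_word_numInv hu
  obtain ⟨M, rfl, hM⟩ := exists_word_numInv hv
  rw [canonicalLift_wordProd hL, canonicalLift_wordProd hM, ← monProd_append, ← wordProd_append,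
    canonicalLift_wordProd]
  rw [wordProd_append, h, List.length_append, hL, hM]

theorem canonicalLift_simple (s : D.S) : canonicalLift D.S (s : E ≃ₗ[ℝ] E) = monGen D.S s := by
  have := canonicalLift_wordProd (L := [s]) (by simp [numInv_simple])
  simpa using this

theorem canonicalLift_one : canonicalLift D.S (1 : E ≃ₗ[ℝ] E) = 1 :=
  canonicalLift_wordProd (L := []) (by simp [numInv_one])

theorem exists_word_canonicalLift {u : E ≃ₗ[ℝ] E} (hu : u ∈ D.W) :
    ∃ L : List D.S, wordProd L = u ∧ monProd L = canonicalLift D.S u := by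
  obtain ⟨L, rfl, hL⟩ := exists_word_numInv hu
  exact ⟨L, rfl, (canonicalLift_wordProd hL).symm⟩

/-! ### The action of `φ` -/

theorem φ_mul_mem {u : E ≃ₗ[ℝ] E} (hu : u ∈ D.W) : D.φ * u * D.φ⁻¹ ∈ D.W :=
  (Subgroup.mem_normalizer_iff.1 D.φ_mem_normalizer u).1 hu

theorem φ_pow_mul_mem {u : E ≃ₗ[ℝ] E} (hu : u ∈ D.W) (k : ℕ) :
    D.φ ^ k * u * (D.φ ^ k)⁻¹ ∈ D.W :=
  (Subgroup.mem_normalizer_iff.1 (pow_mem D.φ_mem_normalizer k) u).1 hu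

variable (D) in
theorem φ_pow_mem_C (k : ℕ) : (D.φ ^ k) D.x₀ ∈ D.C := by
  induction k with
  | zero => exact D.x₀_mem_C
  | succ k ih =>
    rw [pow_succ', ← D.φ_chamber]
    exact ⟨_, ih, rfl⟩

theorem wordProd_map_conjPerm (L : List D.S) :
    wordProd (L.map (conjPerm D.S D.φ D.mem_S_iff)) = D.φ * wordProd L * D.φ⁻¹ := by
  induction L with
  | nil => simp
  | cons s L ih => rw [List.map_cons, wordProd_cons, wordProd_cons, ih]; simp [conjPerm, mul_assoc]

theorem φmon_monProd (L : List D.S) :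
    D.φmon (monProd L) = monProd (L.map (conjPerm D.S D.φ D.mem_S_iff)) := by
  induction L with
  | nil => simp
  | cons s L ih =>
    rw [List.map_cons, monProd_cons, monProd_cons, map_mul, ih]
    rfl

theorem numInv_conj_φ_le {u : E ≃ₗ[ℝ] E} (hu : u ∈ D.W) :
    D.numInv (D.φ * u * D.φ⁻¹) ≤ D.numInv u := by
  obtain ⟨L, rfl, hL⟩ := exists_word_numInv hu
  rw [← wordProd_map_conjPerm, ← hL]
  simpa using numInv_wordProd_le (L.map (conjPerm D.S D.φ D.mem_S_iff))

theorem wordProd_map_conjPerm_symm (L : List D.S) :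
    wordProd (L.map (conjPerm D.S D.φ D.mem_S_iff).symm) = D.φ⁻¹ * wordProd L * D.φ := by
  have := wordProd_map_conjPerm (L.map (conjPerm D.S D.φ D.mem_S_iff).symm)
  rw [List.map_map] at this
  simp only [Equiv.self_comp_symm, List.map_id] at this
  rw [this]; group

theorem numInv_conj_φ {u : E ≃ₗ[ℝ] E} (hu : u ∈ D.W) :
    D.numInv (D.φ * u * D.φ⁻¹) = D.numInv u := by
  refine le_antisymm (numInv_conj_φ_le hu) ?_
  obtain ⟨L, hL', hL⟩ := exists_word_numInv (φ_mul_mem hu)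
  have h := wordProd_map_conjPerm_symm L
  have e : D.φ⁻¹ * (D.φ * u * D.φ⁻¹) * D.φ = u := by group
  rw [hL', e] at h
  rw [← hL, ← h]
  simpa using numInv_wordProd_le (L.map (conjPerm D.S D.φ D.mem_S_iff).symm)

theorem φmon_canonicalLift {u : E ≃ₗ[ℝ] E} (hu : u ∈ D.W) :
    D.φmon (canonicalLift D.S u) = canonicalLift D.S (D.φ * u * D.φ⁻¹) := by
  obtain ⟨L, rfl, hL⟩ := exists_word_numInv hu
  rw [canonicalLift_wordProd hL, φmon_monProd, ← wordProd_map_conjPerm, canonicalLift_wordProd]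
  rw [wordProd_map_conjPerm, numInv_conj_φ hu, List.length_map, hL]

theorem φ_pow_succ_conj (k : ℕ) (u : E ≃ₗ[ℝ] E) :
    D.φ ^ (k + 1) * u * (D.φ ^ (k + 1))⁻¹ = D.φ * (D.φ ^ k * u * (D.φ ^ k)⁻¹) * D.φ⁻¹ := by
  rw [pow_succ']; group

theorem numInv_conj_φ_pow {u : E ≃ₗ[ℝ] E} (hu : u ∈ D.W) (k : ℕ) :
    D.numInv (D.φ ^ k * u * (D.φ ^ k)⁻¹) = D.numInv u := by
  induction k with
  | zero => simp
  | succ k ih => rw [φ_pow_succ_conj, numInv_conj_φ (φ_pow_mul_mem hu k), ih]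

theorem φmon_pow_canonicalLift {u : E ≃ₗ[ℝ] E} (hu : u ∈ D.W) (k : ℕ) :
    (D.φmon ^ k) (canonicalLift D.S u) = canonicalLift D.S (D.φ ^ k * u * (D.φ ^ k)⁻¹) := by
  induction k with
  | zero => simp
  | succ k ih =>
    rw [pow_succ', MulAut.mul_apply, ih, φmon_canonicalLift (φ_pow_mul_mem hu k),
      ← φ_pow_succ_conj]

end RealReflectionCoset

namespace RealReflectionCoset

variable {E : Type*} [AddCommGroup E] [Module ℝ E] {D : RealReflectionCoset E}

/-! ### Stabilizers of points in the closure of the chamber -/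

variable (D) in
/-- The simple reflections fixing `p`. -/
def wallsAt (p : E) : Set (E ≃ₗ[ℝ] E) := {s | s ∈ D.S ∧ s p = p}

theorem wallsAt_subset (p : E) : D.wallsAt p ⊆ D.S := fun _ h => h.1

-- `W` is the stabilizer of the dominant point `0`, so statements about `w_I` specialize to `w₀`.
variable (D) in
theorem wallsAt_zero : D.wallsAt 0 = D.S := by ext s; simp [wallsAt]

variable (D) in
theorem dominant_zero : D.Dominant 0 := fun t _ => by simp

variable {p : E}

theorem apply_eq_of_mem_closure_wallsAt {u : E ≃ₗ[ℝ] E}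
    (hu : u ∈ Subgroup.closure (D.wallsAt p)) : u p = p := by
  induction hu using Subgroup.closure_induction with
  | mem s hs => exact hs.2
  | one => rfl
  | mul a b _ _ iha ihb => change a (b p) = p; rw [ihb, iha]
  | inv a _ iha => conv_lhs => rw [← iha, LinearEquiv.inv_apply_apply]

theorem mem_W_of_mem_closure_wallsAt {u : E ≃ₗ[ℝ] E}
    (hu : u ∈ Subgroup.closure (D.wallsAt p)) : u ∈ D.W := closure_le_W (wallsAt_subset p) hu

theorem root_pos_of_apply_ne (hp : D.Dominant p) {t : E ≃ₗ[ℝ] E} (ht : t ∈ D.T)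
    (h : t p ≠ p) : 0 < D.root t p :=
  lt_of_le_of_ne (hp t ht) fun h0 => h ((root_eq_zero_iff ht).1 h0.symm)

theorem conj_apply_eq_iff {g t : E ≃ₗ[ℝ] E} {y : E} : (g⁻¹ * t * g) y = y ↔ t (g y) = g y := by
  change g⁻¹ (t (g y)) = y ↔ _
  constructor
  · intro h
    conv_rhs => rw [← h, LinearEquiv.apply_inv_apply]
  · intro h
    rw [h, LinearEquiv.inv_apply_apply]

/-- The point `p = u p` is strictly positive for `t` and for its conjugate by `u`, so `u` respects
their positive sides and the sign at `u x₀` follows. -/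
theorem root_apply_pos_of_apply_ne (hp : D.Dominant p) {u t : E ≃ₗ[ℝ] E} (hu : u ∈ D.W)
    (hup : u p = p) (ht : t ∈ D.T) (h : t p ≠ p) : 0 < D.root t (u D.x₀) := by
  have huN := W_le_normalizer hu
  have ht' := conj_mem_T' huN ht
  obtain ⟨c, hc, hr⟩ := exists_root_apply_pos huN ht (a := p)
    (root_pos_of_apply_ne hp ht' (by rwa [Ne, conj_apply_eq_iff, hup]))
    (by rw [hup]; exact root_pos_of_apply_ne hp ht h)
  rw [hr]
  exact mul_pos hc (root_x₀_pos ht')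

/-- The stabilizer of a point in the closure of the chamber is a standard parabolic subgroup. -/
theorem mem_closure_wallsAt (hp : D.Dominant p) {u : E ≃ₗ[ℝ] E} (hu : u ∈ D.W)
    (hup : u p = p) : u ∈ Subgroup.closure (D.wallsAt p) := by
  induction hn : D.numInv u generalizing u with
  | zero => rw [eq_one_of_numInv_eq_zero hu hn]; exact one_mem _
  | succ n ih =>
    obtain ⟨s, hs, hsu⟩ := exists_descent hu (by rintro rfl; simp [numInv_one] at hn)
    have hsT := mem_T_of_mem_S hs
    have hsp : s p = p := by
      by_contra hne
      exact (root_apply_pos_of_apply_ne hp hu hup hsT hne).not_gt hsu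
    have h1 := numInv_simple_mul_of_neg hs hsu
    have h2 := ih (u := s * u) (mul_mem (mem_W_of_mem_S hs) hu) (by
      change s (u p) = p; rw [hup, hsp]) (by omega)
    have h3 := mul_mem (Subgroup.subset_closure (show s ∈ D.wallsAt p from ⟨hs, hsp⟩)) h2
    rwa [← mul_assoc, mul_self_of_mem_T hsT, one_mul] at h3

/-- A point which is on the positive side of the walls through `p` is on the positive side of all
the hyperplanes through `p`. -/
theorem root_nonneg_of_wallsAt (hp : D.Dominant p) {y : E}
    (h : ∀ s ∈ D.wallsAt p, 0 ≤ D.root s y) {t : E ≃ₗ[ℝ] E} (ht : t ∈ D.T) (htp : t p = p) :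
    0 ≤ D.root t y := by
  by_contra! hneg
  -- At `p + ε • y` the hyperplanes not through `p` keep their positive sign, so a wall with
  -- negative sign there must pass through `p`.
  obtain ⟨ε, hε, hε0⟩ := ((((Finset.eventually_all (D.T.filter fun r => 0 < D.root r p)).2
    fun r hr => (D.root r).eventually_pos y (Finset.mem_filter.1 hr).2)).and
    self_mem_nhdsWithin).exists
  replace hε0 : 0 < ε := hε0
  have hz : ∀ {r}, r ∈ D.T → r p = p → D.root r (p + ε • y) = ε * D.root r y := by
    intro r hr hrp
    rw [map_add, map_smul, (root_eq_zero_iff hr).2 hrp, zero_add, smul_eq_mul]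
  obtain ⟨s, hs, hsz⟩ := exists_simple_neg ⟨t, ht, by
    rw [hz ht htp]; exact mul_neg_of_pos_of_neg hε0 hneg⟩
  have hsT := mem_T_of_mem_S hs
  by_cases hsp : s p = p
  · rw [hz hsT hsp] at hsz
    exact (mul_nonneg hε0.le (h s ⟨hs, hsp⟩)).not_gt hsz
  · exact (hε s (Finset.mem_filter.2 ⟨hsT, root_pos_of_apply_ne hp hsT hsp⟩)).not_gt hsz

theorem root_apply_pos_of_wallsAt (hp : D.Dominant p) {v : E ≃ₗ[ℝ] E} (hv : v ∈ D.W)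
    (h : ∀ s ∈ D.wallsAt p, 0 < D.root s (v D.x₀)) {t : E ≃ₗ[ℝ] E} (ht : t ∈ D.T)
    (htp : t p = p) : 0 < D.root t (v D.x₀) :=
  lt_of_le_of_ne (root_nonneg_of_wallsAt hp (fun s hs => (h s hs).le) ht htp)
    (root_W_ne_zero ht hv).symm

/-- Lengths add in `W_I` times the set of `I`-reduced elements. -/
theorem numInv_mul_of_reduced (hp : D.Dominant p) {u v : E ≃ₗ[ℝ] E} (hu : u ∈ D.W)
    (hup : u p = p) (hv : ∀ t ∈ D.T, t p = p → 0 < D.root t (v D.x₀)) :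
    D.numInv (u * v) = D.numInv u + D.numInv v := by
  refine numInv_mul hu fun t ht hneg => ?_
  have htp : t p = p := by
    by_contra hne
    exact (root_apply_pos_of_apply_ne hp hu hup ht hne).not_gt hneg
  have huN := W_le_normalizer hu
  have ht' := conj_mem_T' huN ht
  obtain ⟨c, hc, hr⟩ := exists_root_apply_neg huN ht (root_x₀_pos ht') hneg
  change D.root t (u (v D.x₀)) < 0
  rw [hr]
  refine mul_neg_of_neg_of_pos hc (hv _ ht' ?_)
  rw [conj_apply_eq_iff, hup, htp]

/-! ### Longest elements -/

theorem isLongestIn_wI {I : Set (E ≃ₗ[ℝ] E)} (hI : I ⊆ D.S) : IsLongestIn D.S I (D.wI I) := by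
  refine Classical.epsilon_spec (p := IsLongestIn D.S I) ?_
  have hfin : ((Subgroup.closure I : Subgroup (E ≃ₗ[ℝ] E)) : Set (E ≃ₗ[ℝ] E)).Finite :=
    have := D.finite_W
    (Set.toFinite (D.W : Set (E ≃ₗ[ℝ] E))).subset (closure_le_W hI)
  obtain ⟨w, hw, hmax⟩ := Set.exists_max_image _ (wordLength D.S) hfin ⟨1, one_mem _⟩
  exact ⟨w, hw, hmax⟩

variable (D) in
theorem wI_mem_closure (p : E) : D.wI (D.wallsAt p) ∈ Subgroup.closure (D.wallsAt p) :=
  (isLongestIn_wI (wallsAt_subset p)).1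

variable (D) in
theorem wI_mem (p : E) : D.wI (D.wallsAt p) ∈ D.W :=
  mem_W_of_mem_closure_wallsAt (D.wI_mem_closure p)

variable (D) in
theorem wI_apply (p : E) : D.wI (D.wallsAt p) p = p :=
  apply_eq_of_mem_closure_wallsAt (D.wI_mem_closure p)

/-- By maximality no `s` in `I` lengthens `w_I`, so `-(w_I x₀)` is on the positive side of the walls
through `p`, hence of all hyperplanes through `p`. This also characterizes `w_I` among the elements
of `W`. -/
theorem root_wI_neg_iff (hp : D.Dominant p) {t : E ≃ₗ[ℝ] E} (ht : t ∈ D.T) :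
    D.root t (D.wI (D.wallsAt p) D.x₀) < 0 ↔ t p = p := by
  set w := D.wI (D.wallsAt p) with hw
  have hwW : w ∈ D.W := D.wI_mem p
  constructor
  · intro h
    by_contra hne
    exact (root_apply_pos_of_apply_ne hp hwW (D.wI_apply p) ht hne).not_gt h
  · intro htp
    have h : ∀ s ∈ D.wallsAt p, 0 ≤ D.root s (-(w D.x₀)) := by
      intro s hs
      rw [map_neg, Left.nonneg_neg_iff]
      by_contra! hpos
      have h1 := numInv_simple_mul_of_pos hs.1 hpos
      have hsw : s * w ∈ Subgroup.closure (D.wallsAt p) :=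
        mul_mem (Subgroup.subset_closure hs) (D.wI_mem_closure p)
      have h2 := (isLongestIn_wI (wallsAt_subset p)).2 _ hsw
      change D.len _ ≤ D.len _ at h2
      rw [len_eq_numInv (mem_W_of_mem_closure_wallsAt hsw), len_eq_numInv hwW] at h2
      omega
    have h2 := root_nonneg_of_wallsAt hp h ht htp
    rw [map_neg, Left.nonneg_neg_iff] at h2
    exact lt_of_le_of_ne h2 (root_W_ne_zero ht hwW)

theorem eq_wI_of_root_neg_iff (hp : D.Dominant p) {u : E ≃ₗ[ℝ] E} (hu : u ∈ D.W)
    (h : ∀ t ∈ D.T, D.root t (u D.x₀) < 0 ↔ t p = p) : u = D.wI (D.wallsAt p) :=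
  eq_of_neg_iff_neg hu (D.wI_mem p) fun t ht => (h t ht).trans (root_wI_neg_iff hp ht).symm

/-- `w_I` permutes the reflections fixing `p` and reverses their signs, so its square has no
inversion. -/
theorem wI_mul_self (hp : D.Dominant p) :
    D.wI (D.wallsAt p) * D.wI (D.wallsAt p) = 1 := by
  have hW := D.wI_mem p
  have hN := W_le_normalizer hW
  refine eq_of_neg_iff_neg (mul_mem hW hW) (one_mem _) fun t ht => ?_
  have ht' := conj_mem_T' hN ht
  have htp : (D.wI (D.wallsAt p))⁻¹ * t * D.wI (D.wallsAt p) ∈ D.T ∧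
      (((D.wI (D.wallsAt p))⁻¹ * t * D.wI (D.wallsAt p)) p = p ↔ t p = p) :=
    ⟨ht', by rw [conj_apply_eq_iff, D.wI_apply]⟩
  refine iff_of_false ?_ (root_x₀_pos ht).not_gt
  change ¬ D.root t (D.wI (D.wallsAt p) (D.wI (D.wallsAt p) D.x₀)) < 0
  rw [not_lt]
  by_cases h : t p = p
  · obtain ⟨c, hc, hr⟩ := exists_root_apply_neg hN ht (root_x₀_pos ht')
      ((root_wI_neg_iff hp ht).2 h)
    rw [hr]
    exact mul_nonneg_of_nonpos_of_nonpos hc.le ((root_wI_neg_iff hp ht').2 (htp.2.2 h)).le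
  · exact (root_apply_pos_of_apply_ne hp (mul_mem hW hW) (by
      change D.wI (D.wallsAt p) (D.wI (D.wallsAt p) p) = p
      rw [D.wI_apply, D.wI_apply]) ht h).le

theorem wI_inv (hp : D.Dominant p) : (D.wI (D.wallsAt p))⁻¹ = D.wI (D.wallsAt p) :=
  inv_eq_of_mul_eq_one_left (wI_mul_self hp)

variable (D) in
theorem w₀_eq : D.w₀ = D.wI (D.wallsAt 0) := by rw [wallsAt_zero]; rfl

variable (D) in
theorem w₀_mem : D.w₀ ∈ D.W := D.w₀_eq ▸ D.wI_mem 0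

theorem root_w₀_neg {t : E ≃ₗ[ℝ] E} (ht : t ∈ D.T) : D.root t (D.w₀ D.x₀) < 0 := by
  rw [w₀_eq, root_wI_neg_iff D.dominant_zero ht, map_zero]

variable (D) in
theorem w₀_mul_self : D.w₀ * D.w₀ = 1 := by rw [w₀_eq, wI_mul_self D.dominant_zero]

variable (D) in
theorem w₀_inv : D.w₀⁻¹ = D.w₀ := inv_eq_of_mul_eq_one_left D.w₀_mul_self

/-- Every reflection is an inversion of `w₀`, so every `u` is a prefix of `w₀`. -/
theorem canonicalLift_w₀_left {u : E ≃ₗ[ℝ] E} (hu : u ∈ D.W) :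
    canonicalLift D.S D.w₀ = canonicalLift D.S u * canonicalLift D.S (u⁻¹ * D.w₀) := by
  have hm := mul_mem (inv_mem hu) D.w₀_mem
  have e : u * (u⁻¹ * D.w₀) = D.w₀ := mul_inv_cancel_left _ _
  rw [← canonicalLift_mul hu hm, e]
  exact numInv_mul hu fun t ht _ => by rw [e]; exact root_w₀_neg ht

theorem canonicalLift_w₀_right {u : E ≃ₗ[ℝ] E} (hu : u ∈ D.W) :
    canonicalLift D.S D.w₀ = canonicalLift D.S (D.w₀ * u⁻¹) * canonicalLift D.S u := by
  have := canonicalLift_w₀_left (mul_mem D.w₀_mem (inv_mem hu))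
  simpa using this

/-- Both `w₀ = (w₀ u w₀)(w₀ u⁻¹)` and `w₀ = (w₀ u⁻¹) u` have additive lengths; the two sides are the
same triple product. -/
theorem canonicalLift_w₀_mul {u : E ≃ₗ[ℝ] E} (hu : u ∈ D.W) :
    canonicalLift D.S D.w₀ * canonicalLift D.S u =
      canonicalLift D.S (D.w₀ * u * D.w₀) * canonicalLift D.S D.w₀ := by
  have hu' := mul_mem (mul_mem D.w₀_mem hu) D.w₀_mem
  conv_rhs => rw [canonicalLift_w₀_right hu, ← mul_assoc]
  congr 1
  conv_lhs => rw [canonicalLift_w₀_left hu']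
  rw [mul_inv_rev, mul_inv_rev, w₀_inv, mul_assoc, mul_assoc, mul_assoc, D.w₀_mul_self, mul_one]

/-! ### The element `w_I w_0` -/

variable (D) in
/-- The element `w_I w_0`, where `W_I` is the stabilizer of `p`. -/
noncomputable def coLongest (p : E) : E ≃ₗ[ℝ] E := D.wI (D.wallsAt p) * D.w₀

variable (D) in
theorem coLongest_mem (p : E) : D.coLongest p ∈ D.W := mul_mem (D.wI_mem p) D.w₀_mem

theorem coLongest_inv (hp : D.Dominant p) :
    (D.coLongest p)⁻¹ = D.w₀ * D.wI (D.wallsAt p) := by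
  rw [coLongest, mul_inv_rev, w₀_inv, wI_inv hp]

/-- `w₀` inverts every reflection, and `w_I` undoes this exactly for those fixing `p`. -/
theorem root_coLongest_neg_iff (hp : D.Dominant p) {t : E ≃ₗ[ℝ] E} (ht : t ∈ D.T) :
    D.root t (D.coLongest p D.x₀) < 0 ↔ t p ≠ p := by
  have hN := W_le_normalizer (D.wI_mem p)
  have ht' := conj_mem_T' hN ht
  change D.root t (D.wI (D.wallsAt p) (D.w₀ D.x₀)) < 0 ↔ _
  by_cases h : t p = p
  · obtain ⟨c, hc, hr⟩ := exists_root_apply_neg hN ht (root_x₀_pos ht')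
      ((root_wI_neg_iff hp ht).2 h)
    rw [hr]
    exact iff_of_false (mul_pos_of_neg_of_neg hc (root_w₀_neg ht')).not_gt (not_not.2 h)
  · obtain ⟨c, hc, hr⟩ := exists_root_apply_pos hN ht (root_x₀_pos ht')
      (root_apply_pos_of_apply_ne hp (D.wI_mem p) (D.wI_apply p) ht h)
    rw [hr]
    exact iff_of_true (mul_neg_of_pos_of_neg hc (root_w₀_neg ht')) h

open Classical in
theorem numInv_coLongest (hp : D.Dominant p) :
    D.numInv (D.coLongest p) = (D.T.filter fun t => t p ≠ p).card := by
  rw [numInv, negRoots]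
  exact congrArg _ (Finset.filter_congr fun t ht => root_coLongest_neg_iff hp ht)

/-- An element whose inversions all avoid `p` is a prefix of `w_I w_0`. -/
theorem numInv_coLongest_eq_add (hp : D.Dominant p) {u : E ≃ₗ[ℝ] E} (hu : u ∈ D.W)
    (h : ∀ t ∈ D.T, D.root t (u D.x₀) < 0 → t p ≠ p) :
    D.numInv (D.coLongest p) = D.numInv u + D.numInv (u⁻¹ * D.coLongest p) := by
  have e : u * (u⁻¹ * D.coLongest p) = D.coLongest p := mul_inv_cancel_left _ _
  rw [← numInv_mul hu, e]
  intro t ht hneg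
  rw [e, root_coLongest_neg_iff hp ht]
  exact h t ht hneg

variable (D) in
/-- The element `π/π_I` of the braid monoid. -/
noncomputable def piQuot (p : E) : D.Bmon :=
  canonicalLift D.S (D.coLongest p) * canonicalLift D.S (D.coLongest p)⁻¹

theorem canonicalLift_wI_mul_coLongest (hp : D.Dominant p) :
    canonicalLift D.S (D.wI (D.wallsAt p)) * canonicalLift D.S (D.coLongest p) =
      canonicalLift D.S D.w₀ := by
  rw [canonicalLift_w₀_left (D.wI_mem p), wI_inv hp, coLongest]

theorem piI_eq (p : E) : D.piI (D.wallsAt p) =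
    canonicalLift D.S (D.wI (D.wallsAt p)) * canonicalLift D.S (D.wI (D.wallsAt p)) := sq _

theorem piFull_eq : D.piFull = canonicalLift D.S D.w₀ * canonicalLift D.S D.w₀ := sq _

/-- With `κ = w_I w_0` and all products taken between lifts: `w_I w_I κ κ⁻¹ = w_I w₀ κ⁻¹ = w_I κ w₀
= w₀ w₀`, as `w₀ κ⁻¹ w₀ = κ`. -/
theorem piI_mul_piQuot (hp : D.Dominant p) : D.piI (D.wallsAt p) * D.piQuot p = D.piFull := by
  rw [piI_eq, piFull_eq, piQuot, mul_assoc,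
    ← mul_assoc _ (canonicalLift D.S (D.coLongest p)), canonicalLift_wI_mul_coLongest hp,
    canonicalLift_w₀_mul (inv_mem (D.coLongest_mem p)), ← mul_assoc,
    coLongest_inv hp, ← mul_assoc D.w₀, D.w₀_mul_self, one_mul, ← coLongest,
    canonicalLift_wI_mul_coLongest hp]

theorem piQuot_mul_piI (hp : D.Dominant p) : D.piQuot p * D.piI (D.wallsAt p) = D.piFull := by
  have h1 : canonicalLift D.S (D.coLongest p)⁻¹ * canonicalLift D.S (D.wI (D.wallsAt p)) =
      canonicalLift D.S D.w₀ := by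
    rw [canonicalLift_w₀_right (D.wI_mem p), wI_inv hp, coLongest_inv hp]
  have hc := D.coLongest_mem p
  have h2 : canonicalLift D.S D.w₀ = canonicalLift D.S (D.coLongest p) *
      canonicalLift D.S (D.w₀ * D.wI (D.wallsAt p) * D.w₀) := by
    rw [canonicalLift_w₀_left hc, coLongest_inv hp]
  rw [piI_eq, piFull_eq, piQuot, mul_assoc, ← mul_assoc (canonicalLift D.S (D.coLongest p)⁻¹), h1,
    canonicalLift_w₀_mul (D.wI_mem p), ← mul_assoc, ← h2]

/-- `π/π_I` commutes with the generators in `I`. -/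
theorem piQuot_mul_monGen (hp : D.Dominant p) {s : D.S} (hs : (s : E ≃ₗ[ℝ] E) p = p) :
    D.piQuot p * monGen D.S s = monGen D.S s * D.piQuot p := by
  have hsT := mem_T_of_mem_S s.2
  have hsW := mem_W_of_mem_S s.2
  have hsN := W_le_normalizer hsW
  have hc := D.coLongest_mem p
  set κ := D.coLongest p with hκ
  -- Lengths add in both `s κ = κ r` and `r κ⁻¹ = κ⁻¹ s`, and `r` has length one; so the generator
  -- slides through both factors of `π/π_I`, becoming the lift of `r` in between.
  set r := κ⁻¹ * s * κ with hr_def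
  have hrT : r ∈ D.T := conj_mem_T' (W_le_normalizer hc) hsT
  have hrW := (D.mem_T.1 hrT).1
  have e1 : κ * r = s * κ := by rw [hr_def]; group
  have h1 : D.numInv (s * κ) = D.numInv κ + 1 := by
    refine numInv_simple_mul_of_pos s.2 ((root_pos_or_neg hsT hc).resolve_right ?_)
    rw [root_coLongest_neg_iff hp hsT, not_not, hs]
  have h2 : D.numInv (κ * r) = D.numInv κ + D.numInv r := by
    refine numInv_mul hc fun t ht hneg => ?_
    have htp := (root_coLongest_neg_iff hp ht).1 hneg
    obtain ⟨c, hc, hr⟩ := exists_root_simple_apply s.2 ht (by rintro rfl; exact htp hs)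
    rw [e1]
    change D.root t (s.1 (κ D.x₀)) < 0
    rw [hr]
    refine mul_neg_of_pos_of_neg hc ((root_coLongest_neg_iff hp (conj_mem_T' hsN ht)).2 ?_)
    rwa [Ne, conj_apply_eq_iff, hs]
  have h3 : D.numInv r = 1 := by rw [e1] at h2; omega
  have h4 : canonicalLift D.S s.1 * canonicalLift D.S κ =
      canonicalLift D.S κ * canonicalLift D.S r := by
    rw [← canonicalLift_mul hsW hc (by rw [h1, numInv_simple s.2, add_comm]),
      ← canonicalLift_mul hc hrW h2, e1]
  have e2 : r * κ⁻¹ = κ⁻¹ * s := by rw [hr_def]; group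
  have h5 : D.numInv (r * κ⁻¹) = D.numInv κ + 1 := by
    rw [← numInv_inv (mul_mem hrW (inv_mem hc)), mul_inv_rev, inv_inv, inv_of_mem_T hrT, h2, h3]
  have h6 : canonicalLift D.S r * canonicalLift D.S κ⁻¹ =
      canonicalLift D.S κ⁻¹ * canonicalLift D.S s.1 := by
    rw [← canonicalLift_mul hrW (inv_mem hc) (by rw [h5, h3, numInv_inv hc, add_comm]),
      ← canonicalLift_mul (inv_mem hc) hsW (by rw [← e2, h5, numInv_simple s.2, numInv_inv hc]),
      e2]
  rw [← canonicalLift_simple s, piQuot, mul_assoc, ← h6, ← mul_assoc, ← h4, mul_assoc]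

end RealReflectionCoset

/-! ### Counting sign changes of a sampled cosine -/

/-- The increments of `k ↦ ⌊x + 2k/d⌋` at distance `i` add up to `2i` over a period. -/
theorem sum_range_floor_sub (x : ℝ) {d : ℕ} (hd : 0 < d) (i : ℕ) :
    ∑ k ∈ Finset.range d, (⌊x + 2 * ((k + i : ℕ) : ℝ) / d⌋ - ⌊x + 2 * (k : ℝ) / d⌋) = 2 * i := by
  induction i with
  | zero => simp
  | succ i ih =>
    -- A unit increment, telescoping to `2` over a period, is split off from the increment at
    -- distance `i`.
    have h : ∀ k : ℕ, ⌊x + 2 * ((k + (i + 1) : ℕ) : ℝ) / d⌋ - ⌊x + 2 * (k : ℝ) / d⌋ =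
        (⌊x + 2 * ((k + 1 + i : ℕ) : ℝ) / d⌋ - ⌊x + 2 * ((k + i : ℕ) : ℝ) / d⌋) +
        (⌊x + 2 * ((k + i : ℕ) : ℝ) / d⌋ - ⌊x + 2 * (k : ℝ) / d⌋) := by
      intro k
      rw [show k + (i + 1) = k + 1 + i by ring]
      ring
    rw [Finset.sum_congr rfl fun k _ => h k, Finset.sum_add_distrib, ih,
      Finset.sum_range_sub (fun k => ⌊x + 2 * ((k + i : ℕ) : ℝ) / d⌋)]
    have e : x + 2 * ((d + i : ℕ) : ℝ) / d = x + 2 * ((0 + i : ℕ) : ℝ) / d + (2 : ℤ) := by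
      have : (d : ℝ) ≠ 0 := by positivity
      push_cast
      field_simp
      ring
    rw [e, Int.floor_add_intCast]
    push_cast
    ring

theorem Real.sin_pi_mul_eq (x : ℝ) :
    Real.sin (Real.pi * x) = (-1) ^ ⌊x⌋ * Real.sin (Real.pi * Int.fract x) := by
  conv_lhs => rw [← Int.fract_add_floor x]
  rw [mul_add, mul_comm Real.pi (⌊x⌋ : ℝ), Real.sin_add_int_mul_pi]

/-- The sign of `sin (π x)` is the parity of `⌊x⌋`, and the floor grows by at most one between `x`
and `y`. -/
theorem Real.sin_pi_mul_mul_neg_iff {x y : ℝ} (hx : Real.sin (Real.pi * x) ≠ 0)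
    (hy : Real.sin (Real.pi * y) ≠ 0) (hxy : x ≤ y) (hyx : y ≤ x + 1) :
    (if Real.sin (Real.pi * x) * Real.sin (Real.pi * y) < 0 then (1 : ℤ) else 0) = ⌊y⌋ - ⌊x⌋ := by
  have hpos : ∀ z : ℝ, Real.sin (Real.pi * z) ≠ 0 → 0 < Real.sin (Real.pi * Int.fract z) := by
    intro z hz
    refine lt_of_le_of_ne (Real.sin_nonneg_of_nonneg_of_le_pi
      (mul_nonneg Real.pi_pos.le (Int.fract_nonneg z)) ?_) fun h => hz ?_
    · nlinarith [Real.pi_pos, Int.fract_lt_one z]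
    · rw [Real.sin_pi_mul_eq, ← h, mul_zero]
  have hp := mul_pos (hpos x hx) (hpos y hy)
  have h1 : ⌊x⌋ ≤ ⌊y⌋ := Int.floor_mono hxy
  have h2 : ⌊y⌋ ≤ ⌊x⌋ + 1 := by
    have := Int.floor_mono hyx
    rwa [Int.floor_add_one] at this
  have h3 : Real.sin (Real.pi * x) * Real.sin (Real.pi * y) = (-1) ^ (⌊y⌋ - ⌊x⌋) *
      (Real.sin (Real.pi * Int.fract x) * Real.sin (Real.pi * Int.fract y)) := by
    rw [Real.sin_pi_mul_eq x, Real.sin_pi_mul_eq y, zpow_sub₀ (by norm_num)]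
    have : ((-1 : ℝ) ^ ⌊x⌋)⁻¹ = (-1) ^ ⌊x⌋ := by
      rw [← inv_zpow]; norm_num
    rw [div_eq_mul_inv, this]; ring
  rw [h3]
  rcases (by omega : ⌊y⌋ = ⌊x⌋ ∨ ⌊y⌋ = ⌊x⌋ + 1) with h | h
  · rw [h, sub_self, zpow_zero, one_mul, if_neg hp.not_gt]
  · rw [h, add_sub_cancel_left, zpow_one, if_pos (by linarith)]

/-- The real parts of the `ζ^k z`, with `ζ = exp (2iπ/d)`, change sign exactly `2i` times at
distance `i` along a period, if `2i ≤ d`. -/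
theorem card_sign_changes {d : ℕ} (hd : 0 < d) {i : ℕ} (hi : 2 * i ≤ d) (f : ℕ → ℝ) (a b : ℝ)
    (hf : ∀ k : ℕ, f k =
      Real.cos (2 * Real.pi * k / d) * a - Real.sin (2 * Real.pi * k / d) * b)
    (h0 : ∀ k, f k ≠ 0) :
    ((Finset.range d).filter fun k => f k * f (k + i) < 0).card = 2 * i := by
  set z : ℂ := ⟨a, b⟩ with hz
  -- The shift by `1 / 2` turns the cosine into a sine, whose sign is read from a floor.
  set x : ℝ := z.arg / Real.pi + 1 / 2 with hx
  have hd' : (d : ℝ) ≠ 0 := by positivity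
  have hf' : ∀ k : ℕ, f k = ‖z‖ * Real.sin (Real.pi * (x + 2 * (k : ℝ) / d)) := by
    intro k
    have e : Real.pi * (x + 2 * (k : ℝ) / d) =
        (2 * Real.pi * k / d + z.arg) + Real.pi / 2 := by
      rw [hx]; field_simp; ring
    rw [e, Real.sin_add_pi_div_two, Real.cos_add, hf]
    have ha : ‖z‖ * Real.cos z.arg = a := Complex.norm_mul_cos_arg z
    have hb : ‖z‖ * Real.sin z.arg = b := Complex.norm_mul_sin_arg z
    rw [← ha, ← hb]; ring
  have hz0 : 0 < ‖z‖ := by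
    refine lt_of_le_of_ne (norm_nonneg z) fun h => h0 0 ?_
    rw [hf', ← h, zero_mul]
  have hs : ∀ k : ℕ, Real.sin (Real.pi * (x + 2 * (k : ℝ) / d)) ≠ 0 := fun k h => h0 k (by
    rw [hf', h, mul_zero])
  have key := sum_range_floor_sub x hd i
  rw [← Nat.cast_inj (R := ℤ), Finset.card_filter]
  push_cast
  rw [← key]
  refine Finset.sum_congr rfl fun k _ => ?_
  have hle : x + 2 * (k : ℝ) / d ≤ x + 2 * ((k + i : ℕ) : ℝ) / d := by
    push_cast; gcongr; linarith [Nat.cast_nonneg (α := ℝ) i]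
  -- Here `2 * i ≤ d` ensures that at most one zero of the sine lies between the two samples.
  have hle' : x + 2 * ((k + i : ℕ) : ℝ) / d ≤ x + 2 * (k : ℝ) / d + 1 := by
    have h1 : (2 * i : ℝ) / d ≤ 1 := by
      rw [div_le_one (by positivity)]; exact_mod_cast hi
    have h2 : 2 * ((k + i : ℕ) : ℝ) / d = 2 * (k : ℝ) / d + 2 * i / d := by push_cast; ring
    linarith
  rw [← Real.sin_pi_mul_mul_neg_iff (hs k) (hs (k + i)) hle hle', hf', hf']
  have hiff : ∀ u v : ℝ, ‖z‖ * u * (‖z‖ * v) < 0 ↔ u * v < 0 := fun u v => by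
    rw [show ‖z‖ * u * (‖z‖ * v) = (‖z‖ * ‖z‖) * (u * v) by ring,
      mul_neg_iff_neg_right (mul_pos hz0 hz0)]
  simp only [hiff]

namespace RealReflectionCoset

variable {E : Type*} [AddCommGroup E] [Module ℝ E] {D : RealReflectionCoset E}

/-! ### The complexification -/

variable (E) in
/-- The real part of a vector of the complexification. -/
noncomputable def rePart : (ℂ ⊗[ℝ] E) →ₗ[ℝ] E :=
  (TensorProduct.lid ℝ E).toLinearMap ∘ₗ LinearMap.rTensor E Complex.reLm

variable (E) in
/-- The imaginary part of a vector of the complexification. -/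
noncomputable def imPart : (ℂ ⊗[ℝ] E) →ₗ[ℝ] E :=
  (TensorProduct.lid ℝ E).toLinearMap ∘ₗ LinearMap.rTensor E Complex.imLm

@[simp] theorem rePart_tmul (z : ℂ) (e : E) : rePart E (z ⊗ₜ e) = z.re • e := rfl

@[simp] theorem imPart_tmul (z : ℂ) (e : E) : imPart E (z ⊗ₜ e) = z.im • e := rfl

theorem rePart_smul (z : ℂ) (v : ℂ ⊗[ℝ] E) :
    rePart E (z • v) = z.re • rePart E v - z.im • imPart E v := by
  induction v with
  | zero => simp
  | tmul a e =>
    simp only [TensorProduct.smul_tmul', rePart_tmul, imPart_tmul, smul_eq_mul, Complex.mul_re,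
      smul_smul, sub_smul]
  | add a b ha hb => simp only [smul_add, map_add, ha, hb]; abel

/-- On a complex subspace the imaginary parts are thus among the real parts, so only real parts need
to be tracked. -/
theorem imPart_eq (v : ℂ ⊗[ℝ] E) : imPart E v = rePart E ((-Complex.I) • v) := by
  simp [rePart_smul]

theorem rePart_cx (g : E ≃ₗ[ℝ] E) (v : ℂ ⊗[ℝ] E) : rePart E (cx g v) = g (rePart E v) := by
  induction v with
  | zero => simp
  | tmul a e => simp [cx]
  | add a b ha hb => simp only [map_add, ha, hb]

theorem eq_of_rePart_imPart {v v' : ℂ ⊗[ℝ] E} (h : rePart E v = rePart E v')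
    (h' : imPart E v = imPart E v') : v = v' := by
  have key : ∀ v : ℂ ⊗[ℝ] E, v = 1 ⊗ₜ rePart E v + Complex.I ⊗ₜ imPart E v := by
    intro v
    induction v with
    | zero => simp
    | tmul a e =>
      simp only [rePart_tmul, imPart_tmul, ← TensorProduct.smul_tmul, ← TensorProduct.add_tmul]
      congr 1
      apply Complex.ext <;> simp
    | add a b ha hb =>
      simp only [map_add, TensorProduct.tmul_add]
      conv_lhs => rw [ha, hb]
      abel
  rw [key v, key v', h, h']

theorem cx_mul (g h : E ≃ₗ[ℝ] E) (v : ℂ ⊗[ℝ] E) : cx (g * h) v = cx g (cx h v) := by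
  induction v with
  | zero => simp
  | tmul a e => simp [cx]
  | add a b ha hb => simp only [map_add, ha, hb]

theorem cx_one (v : ℂ ⊗[ℝ] E) : cx (1 : E ≃ₗ[ℝ] E) v = v := by
  induction v with
  | zero => simp
  | tmul a e => simp [cx]
  | add a b ha hb => simp only [map_add, ha, hb]

theorem cx_inv_apply (g : E ≃ₗ[ℝ] E) (v : ℂ ⊗[ℝ] E) : cx g⁻¹ (cx g v) = v := by
  rw [← cx_mul, inv_mul_cancel, cx_one]

/-- `g` fixes a complex subspace pointwise if it fixes the real parts of its vectors. -/
theorem cx_apply_eq_iff_rePart {g : E ≃ₗ[ℝ] E} {V : Submodule ℂ (ℂ ⊗[ℝ] E)} :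
    (∀ v ∈ V, cx g v = v) ↔ ∀ v ∈ V, g (rePart E v) = rePart E v := by
  constructor
  · intro h v hv
    rw [← rePart_cx, h v hv]
  · intro h v hv
    refine eq_of_rePart_imPart (by rw [rePart_cx, h v hv]) ?_
    rw [imPart_eq, ← map_smul, rePart_cx, h _ (V.smul_mem _ hv), imPart_eq]

theorem ActsBy.mul {g h : E ≃ₗ[ℝ] E} {a b : ℂ} {V : Submodule ℂ (ℂ ⊗[ℝ] E)}
    (hg : ActsBy g a V) (hh : ActsBy h b V) : ActsBy (g * h) (a * b) V := by
  intro v hv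
  rw [cx_mul, hh v hv, map_smul, hg v hv, smul_smul, mul_comm]

theorem ActsBy.one (V : Submodule ℂ (ℂ ⊗[ℝ] E)) : ActsBy (1 : E ≃ₗ[ℝ] E) 1 V := by
  intro v _
  rw [cx_one, one_smul]

theorem ActsBy.pow {g : E ≃ₗ[ℝ] E} {a : ℂ} {V : Submodule ℂ (ℂ ⊗[ℝ] E)}
    (hg : ActsBy g a V) (k : ℕ) : ActsBy (g ^ k) (a ^ k) V := by
  induction k with
  | zero => simpa using ActsBy.one V
  | succ k ih => rw [pow_succ, pow_succ]; exact ih.mul hg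

theorem ActsBy.inv {g : E ≃ₗ[ℝ] E} {a : ℂ} (ha : a ≠ 0) {V : Submodule ℂ (ℂ ⊗[ℝ] E)}
    (hg : ActsBy g a V) : ActsBy g⁻¹ a⁻¹ V := by
  intro v hv
  have h := congrArg (cx g⁻¹) (hg _ (V.smul_mem a⁻¹ hv))
  rw [cx_inv_apply, smul_smul, mul_inv_cancel₀ ha, one_smul] at h
  exact h.symm

theorem actsBy_one_iff {g : E ≃ₗ[ℝ] E} {V : Submodule ℂ (ℂ ⊗[ℝ] E)} :
    ActsBy g 1 V ↔ ∀ v ∈ V, cx g v = v := by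
  simp [ActsBy]

end RealReflectionCoset

theorem Braid.twistedPow_succ {M : Type*} [Monoid M] (F : MulAut M) (b : M) (n : ℕ) :
    twistedPow F b (n + 1) = twistedPow F b n * (F ^ n) b := by
  simp [twistedPow, List.range_succ]

theorem Braid.twistedPow_add {M : Type*} [Monoid M] (F : MulAut M) (b : M) (m n : ℕ) :
    twistedPow F b (m + n) = twistedPow F b m * (F ^ m) (twistedPow F b n) := by
  induction n with
  | zero => simp [twistedPow]
  | succ n ih =>
    rw [← add_assoc, twistedPow_succ, ih, twistedPow_succ, map_mul, mul_assoc, ← MulAut.mul_apply,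
      ← pow_add]

namespace RealReflectionCoset

variable {E : Type*} [AddCommGroup E] [Module ℝ E] {D : RealReflectionCoset E}

/-! ### The semidirect product -/

theorem toGrp_φmon (x : D.Bmon) : toGrp D.S (D.φmon x) = D.φgrp (toGrp D.S x) := by
  have h : (toGrp D.S).comp D.φmon.toMonoidHom = D.φgrp.toMonoidHom.comp (toGrp D.S) :=
    PresentedMonoid.ext _ fun s => by
      change toGrp D.S (D.φmon (monGen D.S s)) = D.φgrp (toGrp D.S (monGen D.S s))
      rw [φmon, monAut_monGen, toGrp, monLift_monGen, monLift_monGen, φgrp, grpAut_grpGen]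
  exact DFunLike.congr_fun h x

theorem φelt_mul_toBφ (x : D.Bmon) : D.φelt * D.toBφ x = D.toBφ (D.φmon x) * D.φelt := by
  have h := SemidirectProduct.inl_aut (φ := zpowersHom (MulAut D.Bgrp) D.φgrp)
    (Multiplicative.ofAdd 1) (toGrp D.S x)
  change _ = _ * SemidirectProduct.inl (toGrp D.S x) * _ at h
  rw [φelt, toBφ, MonoidHom.comp_apply, MonoidHom.comp_apply, toGrp_φmon]
  rw [zpowersHom_apply, toAdd_ofAdd, zpow_one] at h
  rw [h, map_inv, inv_mul_cancel_right]

theorem φelt_pow_mul_toBφ (x : D.Bmon) (k : ℕ) :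
    D.φelt ^ k * D.toBφ x = D.toBφ ((D.φmon ^ k) x) * D.φelt ^ k := by
  induction k with
  | zero => simp
  | succ k ih =>
    rw [pow_succ', mul_assoc, ih, ← mul_assoc, φelt_mul_toBφ, pow_succ', MulAut.mul_apply,
      mul_assoc]

theorem toBφ_mul_φelt_pow (b : D.Bmon) (k : ℕ) :
    (D.toBφ b * D.φelt) ^ k = D.toBφ (twistedPow D.φmon b k) * D.φelt ^ k := by
  induction k with
  | zero => simp [twistedPow]
  | succ k ih =>
    rw [pow_succ, ih, twistedPow_succ, map_mul, mul_assoc, ← mul_assoc (D.φelt ^ k),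
      φelt_pow_mul_toBφ, pow_succ]
    simp only [mul_assoc]

theorem stabilizes_of_forall {b : D.Bmon} {I : Set (E ≃ₗ[ℝ] E)}
    (h : ∀ s : D.S, (s : E ≃ₗ[ℝ] E) ∈ I → ∃ s' : D.S, (s' : E ≃ₗ[ℝ] E) ∈ I ∧
      b * D.φmon (monGen D.S s) = monGen D.S s' * b)
    (h' : ∀ s' : D.S, (s' : E ≃ₗ[ℝ] E) ∈ I → ∃ s : D.S, (s : E ≃ₗ[ℝ] E) ∈ I ∧
      b * D.φmon (monGen D.S s) = monGen D.S s' * b) : D.Stabilizes b I := by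
  have key : ∀ {s s' : D.S}, b * D.φmon (monGen D.S s) = monGen D.S s' * b →
      MulAut.conj (D.toBφ b * D.φelt) (D.toBφ (monGen D.S s)) = D.toBφ (monGen D.S s') := by
    intro s s' hs
    rw [MulAut.conj_apply, mul_inv_eq_iff_eq_mul, mul_assoc, φelt_mul_toBφ, ← mul_assoc,
      ← map_mul, hs, map_mul, mul_assoc]
  refine ⟨Set.Subset.antisymm ?_ ?_, Set.Subset.antisymm ?_ ?_⟩
  · rintro _ ⟨_, ⟨s, hs, rfl⟩, rfl⟩
    obtain ⟨s', hs', e⟩ := h s hs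
    exact ⟨_, ⟨s', hs', rfl⟩, e.symm⟩
  · rintro _ ⟨_, ⟨s', hs', rfl⟩, rfl⟩
    obtain ⟨s, hs, e⟩ := h' s' hs'
    exact ⟨_, ⟨s, hs, rfl⟩, e⟩
  · rintro _ ⟨_, ⟨_, ⟨s, hs, rfl⟩, rfl⟩, rfl⟩
    obtain ⟨s', hs', e⟩ := h s hs
    exact ⟨_, ⟨s', hs', rfl⟩, (key e).symm⟩
  · rintro _ ⟨_, ⟨s', hs', rfl⟩, rfl⟩
    obtain ⟨s, hs, e⟩ := h' s' hs'
    exact ⟨_, ⟨_, ⟨s, hs, rfl⟩, rfl⟩, key e⟩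

/-! ### Powers of an element of the coset -/

variable (D) in
/-- The component in `W` of `(w φ)^k`. -/
def cosetPow (w : E ≃ₗ[ℝ] E) (k : ℕ) : E ≃ₗ[ℝ] E := (w * D.φ) ^ k * (D.φ ^ k)⁻¹

theorem cosetPow_add (w : E ≃ₗ[ℝ] E) (m n : ℕ) :
    D.cosetPow w (m + n) = D.cosetPow w m * (D.φ ^ m * D.cosetPow w n * (D.φ ^ m)⁻¹) := by
  simp only [cosetPow, pow_add]; group

@[simp] theorem cosetPow_zero (w : E ≃ₗ[ℝ] E) : D.cosetPow w 0 = 1 := by simp [cosetPow]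

@[simp] theorem cosetPow_one (w : E ≃ₗ[ℝ] E) : D.cosetPow w 1 = w := by simp [cosetPow]

theorem cosetPow_mem {w : E ≃ₗ[ℝ] E} (hw : w ∈ D.W) (k : ℕ) : D.cosetPow w k ∈ D.W := by
  induction k with
  | zero => simp
  | succ k ih => rw [cosetPow_add, cosetPow_one]; exact mul_mem ih (φ_pow_mul_mem hw k)

/-- `φ ^ k` preserves the chamber and `p`, so the conjugate has the inversions that characterize
`w_I`. -/
theorem conj_φ_pow_wI {p : E} (hp : D.Dominant p) {k : ℕ} (hk : (D.φ ^ k) p = p) :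
    D.φ ^ k * D.wI (D.wallsAt p) * (D.φ ^ k)⁻¹ = D.wI (D.wallsAt p) := by
  have hW := φ_pow_mul_mem (D.wI_mem p) k
  refine eq_wI_of_root_neg_iff hp hW fun t ht => ?_
  have hN := pow_mem D.φ_mem_normalizer k
  have ht' := conj_mem_T' hN ht
  have h1 := negRoots_apply_of_mem_C (W_le_normalizer hW) (D.φ_pow_mem_C k)
  have h2 : (D.φ ^ k * D.wI (D.wallsAt p) * (D.φ ^ k)⁻¹) ((D.φ ^ k) D.x₀) =
      (D.φ ^ k) (D.wI (D.wallsAt p) D.x₀) := by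
    change (D.φ ^ k) (D.wI (D.wallsAt p) ((D.φ ^ k)⁻¹ ((D.φ ^ k) D.x₀))) = _
    rw [LinearEquiv.inv_apply_apply]
  rw [h2] at h1
  have h3 := Finset.ext_iff.1 h1 t
  rw [mem_negRoots, mem_negRoots, and_iff_right ht, and_iff_right ht] at h3
  obtain ⟨c, hc, hr⟩ := exists_root_apply_pos hN ht (root_x₀_pos ht')
    (mem_C_iff.1 (D.φ_pow_mem_C k) t ht)
  rw [← h3, hr, mul_neg_iff_neg_right hc, root_wI_neg_iff hp ht', conj_apply_eq_iff, hk]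

theorem conj_φ_pow_coLongest {p : E} (hp : D.Dominant p) {k : ℕ} (hk : (D.φ ^ k) p = p) :
    D.φ ^ k * D.coLongest p * (D.φ ^ k)⁻¹ = D.coLongest p := by
  have h1 := conj_φ_pow_wI hp hk
  have h2 := conj_φ_pow_wI D.dominant_zero (k := k) (map_zero _)
  rw [← w₀_eq] at h2
  rw [coLongest]
  calc _ = (D.φ ^ k * D.wI (D.wallsAt p) * (D.φ ^ k)⁻¹) * (D.φ ^ k * D.w₀ * (D.φ ^ k)⁻¹) := by
        group
    _ = _ := by rw [h1, h2]

theorem φmon_pow_piQuot {p : E} (hp : D.Dominant p) {k : ℕ} (hk : (D.φ ^ k) p = p) :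
    (D.φmon ^ k) (D.piQuot p) = D.piQuot p := by
  have h1 := conj_φ_pow_coLongest hp hk
  have h2 : D.φ ^ k * (D.coLongest p)⁻¹ * (D.φ ^ k)⁻¹ = (D.coLongest p)⁻¹ := by
    conv_rhs => rw [← h1]
    group
  rw [piQuot, map_mul, φmon_pow_canonicalLift (D.coLongest_mem p),
    φmon_pow_canonicalLift (inv_mem (D.coLongest_mem p)), h1, h2]

/-! ### Eigenspaces in good position -/

variable (D) in
/-- The vector `v` of `V` has its real part in the closure of the chamber and outside the
hyperplanes that do not contain `V`. -/
structure IsGoodVector (V : Submodule ℂ (ℂ ⊗[ℝ] E)) (v : ℂ ⊗[ℝ] E) : Prop where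
  mem : v ∈ V
  dominant : D.Dominant (rePart E v)
  generic : ∀ t ∈ D.T, t (rePart E v) = rePart E v → ∀ v' ∈ V, t (rePart E v') = rePart E v'

/-- The real parts of `V` form a real subspace; finitely many linear forms, none of them zero on it,
are simultaneously nonzero at some point of it. -/
theorem exists_generic (V : Submodule ℂ (ℂ ⊗[ℝ] E)) : ∃ v ∈ V,
    ∀ t ∈ D.T, t (rePart E v) = rePart E v → ∀ v' ∈ V, t (rePart E v') = rePart E v' := by
  classical
  obtain ⟨p, hp, h⟩ := Module.Dual.exists_forall_mem_ne_zero_of_forall_exists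
    ((V.restrictScalars ℝ).map (rePart E))
    (fun i : {t // t ∈ D.T.filter fun t : E ≃ₗ[ℝ] E =>
        ¬ ∀ v' ∈ V, t (rePart E v') = rePart E v'} =>
      D.root i.1) (by
      rintro ⟨t, ht⟩
      obtain ⟨ht, h⟩ := Finset.mem_filter.1 ht
      push Not at h
      obtain ⟨v, hv, hne⟩ := h
      exact ⟨_, ⟨v, hv, rfl⟩, fun h0 => hne ((root_eq_zero_iff ht).1 h0)⟩)
  obtain ⟨v, hv, rfl⟩ := hp
  refine ⟨v, hv, fun t ht htv => ?_⟩
  by_contra hne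
  exact h ⟨t, Finset.mem_filter.2 ⟨ht, hne⟩⟩ ((root_eq_zero_iff ht).2 htv)

theorem exists_isGoodVector (V : Submodule ℂ (ℂ ⊗[ℝ] E)) :
    ∃ x ∈ D.W, ∃ v, D.IsGoodVector (V.map (cx x)) v := by
  obtain ⟨v, hv, h⟩ := D.exists_generic V
  obtain ⟨x, hx, hdom⟩ := D.exists_dominant_apply (rePart E v)
  replace hx := closure_S_le hx
  refine ⟨x, hx, cx x v, ⟨v, hv, rfl⟩, by rwa [rePart_cx], ?_⟩
  rintro t ht htv _ ⟨v', hv', rfl⟩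
  have ht' := conj_mem_T' (W_le_normalizer hx) ht
  rw [rePart_cx] at htv ⊢
  exact conj_apply_eq_iff.1 (h _ ht' (conj_apply_eq_iff.2 htv) v' hv')

namespace IsGoodVector

variable {V : Submodule ℂ (ℂ ⊗[ℝ] E)} {v : ℂ ⊗[ℝ] E} (hv : D.IsGoodVector V v)

include hv

theorem apply_eq_of_mem_closure {u : E ≃ₗ[ℝ] E}
    (hu : u ∈ Subgroup.closure (D.wallsAt (rePart E v))) :
    ∀ v' ∈ V, u (rePart E v') = rePart E v' := by
  induction hu using Subgroup.closure_induction with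
  | mem s hs => exact hv.generic s (mem_T_of_mem_S hs.1) hs.2
  | one => exact fun _ _ => rfl
  | mul a b _ _ iha ihb =>
    intro v' hv'
    change a (b _) = _
    rw [ihb v' hv', iha v' hv']
  | inv a _ iha =>
    intro v' hv'
    conv_lhs => rw [← iha v' hv', LinearEquiv.inv_apply_apply]

/-- The stabilizer of `p` is generated by walls through `p`, and by genericity each of these
reflections fixes all of `V`. -/
theorem fixator_eq : D.fixator V =
    (Subgroup.closure (D.wallsAt (rePart E v)) : Set (E ≃ₗ[ℝ] E)) := by
  ext u
  constructor
  · rintro ⟨hu, h⟩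
    exact mem_closure_wallsAt hv.dominant hu (cx_apply_eq_iff_rePart.1 h v hv.mem)
  · intro hu
    exact ⟨mem_W_of_mem_closure_wallsAt hu,
      cx_apply_eq_iff_rePart.2 (hv.apply_eq_of_mem_closure hu)⟩

theorem actsBy_iff {ζ : ℂ} (hζ : ζ ≠ 0) {w : E ≃ₗ[ℝ] E} (hw : w ∈ D.W)
    (hact : ActsBy (w * D.φ) ζ V) {g : E ≃ₗ[ℝ] E} (hg : g ∈ D.W) :
    ActsBy (g * D.φ) ζ V ↔ ∃ u ∈ Subgroup.closure (D.wallsAt (rePart E v)), g = u * w := by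
  constructor
  · intro h
    have h1 := h.mul (hact.inv hζ)
    rw [mul_inv_cancel₀ hζ, show g * D.φ * (w * D.φ)⁻¹ = g * w⁻¹ by group] at h1
    have h2 : g * w⁻¹ ∈ D.fixator V := ⟨mul_mem hg (inv_mem hw), actsBy_one_iff.1 h1⟩
    rw [hv.fixator_eq] at h2
    exact ⟨_, h2, by group⟩
  · rintro ⟨u, hu, rfl⟩
    have h1 : u ∈ D.fixator V := by rw [hv.fixator_eq]; exact hu
    have h2 := (actsBy_one_iff.2 h1.2).mul hact
    rwa [one_mul, ← mul_assoc] at h2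

theorem exists_isReducedRep {ζ : ℂ} (hζ : ζ ≠ 0) (h : ∃ g ∈ D.W, ActsBy (g * D.φ) ζ V) :
    ∃ w, D.IsReducedRep ζ V (D.wallsAt (rePart E v)) w := by
  have hfin : {g | g ∈ D.W ∧ ActsBy (g * D.φ) ζ V}.Finite :=
    have := D.finite_W
    (Set.toFinite (D.W : Set (E ≃ₗ[ℝ] E))).subset fun _ h => h.1
  -- A shortest element of the coset is `I`-reduced.
  obtain ⟨w, ⟨hw, hact⟩, hmin⟩ := Set.exists_min_image _ D.numInv hfin h
  refine ⟨w, hw, fun g hg => hv.actsBy_iff hζ hw hact hg, fun s hs => ?_⟩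
  have hsW := mul_mem (mem_W_of_mem_S hs.1) hw
  rw [len_eq_numInv hw, len_eq_numInv hsW, numInv_lt_simple_mul_iff hs.1 hw]
  refine (root_pos_or_neg (mem_T_of_mem_S hs.1) hw).resolve_right fun hneg => ?_
  have h1 := numInv_simple_mul_of_neg hs.1 hneg
  have h2 := hmin (s * w)
    ⟨hsW, (hv.actsBy_iff hζ hw hact hsW).2 ⟨s, Subgroup.subset_closure hs, rfl⟩⟩
  omega

/-- An element acting on `V` by a scalar preserves the set of the reflections fixing `V`. -/
theorem conj_apply_eq_iff_of_actsBy {g : E ≃ₗ[ℝ] E} {a : ℂ} (ha : a ≠ 0)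
    (hg : g ∈ Subgroup.normalizer (D.W : Set (E ≃ₗ[ℝ] E))) (hact : ActsBy g a V)
    {t : E ≃ₗ[ℝ] E} (ht : t ∈ D.T) :
    (g⁻¹ * t * g) (rePart E v) = rePart E v ↔ t (rePart E v) = rePart E v := by
  constructor
  · intro h
    -- Genericity is applied to `a⁻¹ • v`, the vector of `V` that `g` sends to `v`.
    have h1 := conj_apply_eq_iff.1
      (hv.generic _ (conj_mem_T' hg ht) h _ (V.smul_mem a⁻¹ hv.mem))
    rwa [← rePart_cx, hact _ (V.smul_mem a⁻¹ hv.mem), smul_smul, mul_inv_cancel₀ ha,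
      one_smul] at h1
  · intro h
    rw [conj_apply_eq_iff, ← rePart_cx, hact v hv.mem]
    exact hv.generic t ht h _ (V.smul_mem a hv.mem)

end IsGoodVector

end RealReflectionCoset

/-! ### Reduced representatives: inversions, lengths and braid lifts of their powers -/

namespace RealReflectionCoset

variable {E : Type*} [AddCommGroup E] [Module ℝ E] {D : RealReflectionCoset E}

variable (D) in
/-- The vector `v` of `V` is in good position, and `w φ` acts on `V` by `ζ`, where `w` is reduced
with respect to the stabilizer of `V`. -/
structure IsGoodPair (ζ : ℂ) (V : Submodule ℂ (ℂ ⊗[ℝ] E)) (v : ℂ ⊗[ℝ] E)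
    (w : E ≃ₗ[ℝ] E) : Prop extends D.IsGoodVector V v where
  ne_zero : ζ ≠ 0
  mem_W : w ∈ D.W
  acts : ActsBy (w * D.φ) ζ V
  reduced : ∀ s ∈ D.wallsAt (rePart E v), 0 < D.root s (w D.x₀)

theorem IsGoodVector.isGoodPair {V : Submodule ℂ (ℂ ⊗[ℝ] E)} {v : ℂ ⊗[ℝ] E}
    (hv : D.IsGoodVector V v) {ζ : ℂ} (hζ : ζ ≠ 0) {w : E ≃ₗ[ℝ] E}
    (hw : D.IsReducedRep ζ V (D.wallsAt (rePart E v)) w) : D.IsGoodPair ζ V v w where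
  toIsGoodVector := hv
  ne_zero := hζ
  mem_W := hw.1
  acts := (hw.2.1 w hw.1).2 ⟨1, one_mem _, (one_mul w).symm⟩
  reduced := fun s hs => by
    rw [← numInv_lt_simple_mul_iff hs.1 hw.1, ← len_eq_numInv hw.1,
      ← len_eq_numInv (mul_mem (mem_W_of_mem_S hs.1) hw.1)]
    exact hw.2.2 s hs

namespace IsGoodPair

variable {ζ : ℂ} {V : Submodule ℂ (ℂ ⊗[ℝ] E)} {v : ℂ ⊗[ℝ] E} {w : E ≃ₗ[ℝ] E}

theorem mem_normalizer (h : D.IsGoodPair ζ V v w) (k : ℕ) :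
    (w * D.φ) ^ k ∈ Subgroup.normalizer (D.W : Set (E ≃ₗ[ℝ] E)) :=
  pow_mem (mul_mem (W_le_normalizer h.mem_W) D.φ_mem_normalizer) k

theorem pow_apply (h : D.IsGoodPair ζ V v w) (k : ℕ) :
    ((w * D.φ) ^ k) (rePart E v) = rePart E (ζ ^ k • v) := by
  rw [← rePart_cx, h.acts.pow k v h.mem]

theorem conj_pow_apply_eq_iff (h : D.IsGoodPair ζ V v w) (k : ℕ) {t : E ≃ₗ[ℝ] E} (ht : t ∈ D.T) :
    (((w * D.φ) ^ k)⁻¹ * t * (w * D.φ) ^ k) (rePart E v) = rePart E v ↔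
      t (rePart E v) = rePart E v :=
  h.conj_apply_eq_iff_of_actsBy (pow_ne_zero k h.ne_zero) (h.mem_normalizer k)
    (h.acts.pow k) ht

theorem conj_apply_eq_iff (h : D.IsGoodPair ζ V v w) {t : E ≃ₗ[ℝ] E} (ht : t ∈ D.T) :
    ((w * D.φ)⁻¹ * t * (w * D.φ)) (rePart E v) = rePart E v ↔
      t (rePart E v) = rePart E v := by
  simpa using h.conj_pow_apply_eq_iff 1 ht

theorem root_pos (h : D.IsGoodPair ζ V v w) {t : E ≃ₗ[ℝ] E} (ht : t ∈ D.T)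
    (htv : t (rePart E v) = rePart E v) : 0 < D.root t (w D.x₀) :=
  root_apply_pos_of_wallsAt h.dominant h.mem_W h.reduced ht htv

/-- `wφ` permutes the reflections fixing `V`, and respects their positive sides because `w` is
reduced and `φ` preserves the chamber. -/
theorem root_pow_apply_pos (h : D.IsGoodPair ζ V v w) (k : ℕ) {t : E ≃ₗ[ℝ] E} (ht : t ∈ D.T)
    (htv : t (rePart E v) = rePart E v) : 0 < D.root t (((w * D.φ) ^ k) D.x₀) := by
  induction k generalizing t with
  | zero => exact root_x₀_pos ht
  | succ k ih =>
    have hN := h.mem_normalizer 1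
    rw [pow_one] at hN
    have ht' := conj_mem_T' hN ht
    have h1 : 0 < D.root t ((w * D.φ) D.x₀) := by
      have h2 := Finset.ext_iff.1
        (negRoots_apply_of_mem_C (W_le_normalizer h.mem_W) (D.φ_pow_mem_C 1)) t
      rw [mem_negRoots, mem_negRoots, and_iff_right ht, and_iff_right ht, pow_one] at h2
      have h3 := (not_congr h2).2 (h.root_pos ht htv).not_gt
      exact lt_of_le_of_ne (not_lt.1 h3) (root_apply_ne_zero hN ht).symm
    obtain ⟨c, hc, hr⟩ := exists_root_apply_pos hN ht (root_x₀_pos ht') h1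
    rw [pow_succ']
    change 0 < D.root t ((w * D.φ) (((w * D.φ) ^ k) D.x₀))
    rw [hr]
    exact mul_pos hc (ih ht' ((h.conj_apply_eq_iff ht).2 htv))

/-- The conjugate form is positive at `p` as well as at `x₀`, so `(wφ)^k p` and `(wφ)^k x₀` lie on
the same side of the hyperplane of `t`. -/
theorem exists_root_pow_apply (h : D.IsGoodPair ζ V v w) (k : ℕ) {t : E ≃ₗ[ℝ] E} (ht : t ∈ D.T)
    (htv : t (rePart E v) ≠ rePart E v) :
    ∃ c : ℝ, c ≠ 0 ∧ (∀ y, D.root t (((w * D.φ) ^ k) y) =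
      c * D.root (((w * D.φ) ^ k)⁻¹ * t * (w * D.φ) ^ k) y) ∧
      0 < D.root (((w * D.φ) ^ k)⁻¹ * t * (w * D.φ) ^ k) (rePart E v) := by
  obtain ⟨c, hc, hr⟩ := exists_root_apply (h.mem_normalizer k) ht
  exact ⟨c, hc, hr, root_pos_of_apply_ne h.dominant (conj_mem_T' (h.mem_normalizer k) ht)
    ((not_congr (h.conj_pow_apply_eq_iff k ht)).2 htv)⟩

/-- Reflections fixing `p` are never inversions, as `w` is reduced. For the others `x₀` may be
replaced by `p`, which turns inversions into sign changes along the orbit of `p`. -/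
theorem root_cosetPow_neg_iff (h : D.IsGoodPair ζ V v w) (k : ℕ) {t : E ≃ₗ[ℝ] E}
    (ht : t ∈ D.T) : D.root t (D.cosetPow w k D.x₀) < 0 ↔
      t (rePart E v) ≠ rePart E v ∧ D.root t (((w * D.φ) ^ k) (rePart E v)) < 0 := by
  have h2 := Finset.ext_iff.1
    (negRoots_apply_of_mem_C (W_le_normalizer (cosetPow_mem h.mem_W k)) (D.φ_pow_mem_C k)) t
  rw [mem_negRoots, mem_negRoots, and_iff_right ht, and_iff_right ht] at h2
  have e : D.cosetPow w k ((D.φ ^ k) D.x₀) = ((w * D.φ) ^ k) D.x₀ := by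
    change ((w * D.φ) ^ k) ((D.φ ^ k)⁻¹ ((D.φ ^ k) D.x₀)) = _
    rw [LinearEquiv.inv_apply_apply]
  rw [← h2, e]
  by_cases htv : t (rePart E v) = rePart E v
  · simp only [htv, ne_eq, not_true_eq_false, false_and, iff_false]
    exact (h.root_pow_apply_pos k ht htv).not_gt
  · obtain ⟨c, hc, hr, hpos⟩ := h.exists_root_pow_apply k ht htv
    rw [and_iff_right htv, hr, hr, mul_comm c, mul_comm c, mul_neg_iff_neg_right hpos,
      mul_neg_iff_neg_right (root_x₀_pos (conj_mem_T' (h.mem_normalizer k) ht))]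

/-- When `ζ ^ k = 1`, the point `(wφ)^k p = p` is dominant, so there is no inversion. -/
theorem cosetPow_eq_one (h : D.IsGoodPair ζ V v w) {k : ℕ} (hk : ζ ^ k = 1) :
    D.cosetPow w k = 1 := by
  refine eq_one_of_dominant (cosetPow_mem h.mem_W k) fun t ht => not_lt.1 fun hneg => ?_
  have h1 := ((h.root_cosetPow_neg_iff k ht).1 hneg).2
  rw [h.pow_apply, hk, one_smul] at h1
  exact (h.dominant t ht).not_gt h1

theorem φ_pow_apply (h : D.IsGoodPair ζ V v w) {k : ℕ} (hk : ζ ^ k = 1) :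
    (D.φ ^ k) (rePart E v) = rePart E v := by
  have h1 := h.cosetPow_eq_one hk
  rw [cosetPow, mul_inv_eq_one] at h1
  rw [← h1, h.pow_apply, hk, one_smul]

/-- The conjugate `t` of `s` by `wφ` fixes `p`, so `l(t w) = l(t) + l(w)` as `w` is reduced; but `t
w = w · φsφ⁻¹` has length at most `l(w) + 1`, so `t` is simple. -/
theorem conj_mem_wallsAt (h : D.IsGoodPair ζ V v w) {s : E ≃ₗ[ℝ] E}
    (hs : s ∈ D.wallsAt (rePart E v)) :
    (w * D.φ) * s * (w * D.φ)⁻¹ ∈ D.wallsAt (rePart E v) ∧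
      D.numInv (w * (D.φ * s * D.φ⁻¹)) = D.numInv w + 1 := by
  set t := (w * D.φ) * s * (w * D.φ)⁻¹ with ht_def
  have hN := h.mem_normalizer 1
  rw [pow_one] at hN
  have ht : t ∈ D.T := conj_mem_T hN (mem_T_of_mem_S hs.1)
  have htW := (D.mem_T.1 ht).1
  have htv : t (rePart E v) = rePart E v := by
    rw [← h.conj_apply_eq_iff ht, show (w * D.φ)⁻¹ * t * (w * D.φ) = s by rw [ht_def]; group]
    exact hs.2
  have e : w * (D.φ * s * D.φ⁻¹) = t * w := by rw [ht_def]; group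
  have h1 := numInv_mul_of_reduced h.dominant htW htv fun r hr hrv => h.root_pos hr hrv
  have h2 := numInv_mul_le h.mem_W (φ_mul_mem (mem_W_of_mem_S hs.1))
  rw [numInv_conj_φ (mem_W_of_mem_S hs.1), numInv_simple hs.1, e, h1] at h2
  have h3 := mem_S_of_numInv_le_one ht (by omega)
  refine ⟨⟨h3, htv⟩, ?_⟩
  rw [e, h1, numInv_simple h3, add_comm]

theorem exists_conj_eq (h : D.IsGoodPair ζ V v w) {s' : E ≃ₗ[ℝ] E}
    (hs' : s' ∈ D.wallsAt (rePart E v)) :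
    ∃ s ∈ D.wallsAt (rePart E v), (w * D.φ) * s * (w * D.φ)⁻¹ = s' := by
  have hfin : (D.wallsAt (rePart E v)).Finite :=
    D.T.finite_toSet.subset fun _ hs => mem_T_of_mem_S hs.1
  have := hfin.to_subtype
  let f : D.wallsAt (rePart E v) → D.wallsAt (rePart E v) := fun s =>
    ⟨_, (h.conj_mem_wallsAt s.2).1⟩
  have hf : Function.Injective f := fun a b hab => by
    have := congrArg Subtype.val hab
    simp only [f] at this
    exact Subtype.ext (mul_left_cancel (mul_right_cancel this))
  obtain ⟨s, hs⟩ := Finite.surjective_of_injective hf ⟨s', hs'⟩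
  exact ⟨s, s.2, congrArg Subtype.val hs⟩

theorem canonicalLift_mul_φmon (h : D.IsGoodPair ζ V v w) {s s' : D.S}
    (hs : (s : E ≃ₗ[ℝ] E) ∈ D.wallsAt (rePart E v))
    (hs' : (w * D.φ) * s * (w * D.φ)⁻¹ = (s' : E ≃ₗ[ℝ] E)) :
    canonicalLift D.S w * D.φmon (monGen D.S s) = monGen D.S s' * canonicalLift D.S w := by
  have hsW := mem_W_of_mem_S s.2
  have h1 := (h.conj_mem_wallsAt hs).2
  have e : w * (D.φ * s * D.φ⁻¹) = s' * w := by rw [← hs']; group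
  rw [← canonicalLift_simple, ← canonicalLift_simple, φmon_canonicalLift hsW,
    ← canonicalLift_mul h.mem_W (φ_mul_mem hsW), e, canonicalLift_mul (mem_W_of_mem_S s'.2) h.mem_W]
  · rw [← e, h1, numInv_simple s'.2, add_comm]
  · rw [h1, numInv_conj_φ hsW, numInv_simple s.2]

theorem stabilizes_canonicalLift (h : D.IsGoodPair ζ V v w) :
    D.Stabilizes (canonicalLift D.S w) (D.wallsAt (rePart E v)) := by
  refine stabilizes_of_forall (fun s hs => ?_) (fun s' hs' => ?_)
  · have h1 := (h.conj_mem_wallsAt hs).1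
    exact ⟨⟨_, h1.1⟩, h1, h.canonicalLift_mul_φmon hs rfl⟩
  · obtain ⟨s, hs, e⟩ := h.exists_conj_eq hs'
    exact ⟨⟨s, hs.1⟩, hs, h.canonicalLift_mul_φmon (s := ⟨s, hs.1⟩) hs e⟩

/-- For `w = 1` conjugation by `φ` already permutes `I`, and `π/π_I` commutes with the generators in
`I`. -/
theorem stabilizes_piQuot (h : D.IsGoodPair ζ V v 1) :
    D.Stabilizes (D.piQuot (rePart E v)) (D.wallsAt (rePart E v)) := by
  have key : ∀ {s s' : D.S}, (s' : E ≃ₗ[ℝ] E) ∈ D.wallsAt (rePart E v) →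
      (1 * D.φ) * s * (1 * D.φ)⁻¹ = (s' : E ≃ₗ[ℝ] E) → D.piQuot (rePart E v) *
        D.φmon (monGen D.S s) = monGen D.S s' * D.piQuot (rePart E v) := by
    intro s s' hs' e
    rw [← piQuot_mul_monGen h.dominant hs'.2, ← canonicalLift_simple,
      φmon_canonicalLift (mem_W_of_mem_S s.2), ← canonicalLift_simple, ← e, one_mul]
  refine stabilizes_of_forall (fun s hs => ?_) (fun s' hs' => ?_)
  · have h1 := (h.conj_mem_wallsAt hs).1
    exact ⟨⟨_, h1.1⟩, h1, key (s' := ⟨_, h1.1⟩) h1 rfl⟩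
  · obtain ⟨s, hs, e⟩ := h.exists_conj_eq hs'
    exact ⟨⟨s, hs.1⟩, hs, key (s := ⟨s, hs.1⟩) hs' e⟩

section

variable {d : ℕ}

theorem exp_pow_eq (d k : ℕ) : Complex.exp (2 * Real.pi * Complex.I / d) ^ k =
    Complex.exp ((2 * Real.pi * k / d : ℝ) * Complex.I) := by
  rw [← Complex.exp_nat_mul]
  congr 1
  push_cast
  ring

theorem exp_pow_self (hd : 0 < d) : Complex.exp (2 * Real.pi * Complex.I / d) ^ d = 1 := by
  have : (d : ℂ) ≠ 0 := by exact_mod_cast hd.ne'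
  rw [← Complex.exp_nat_mul, mul_div_cancel₀ _ this, Complex.exp_two_pi_mul_I]

/-- The length of the component in `W` of `(w φ)^i`, for `2i ≤ d`. -/
theorem mul_numInv_cosetPow (hd : 0 < d)
    (h : D.IsGoodPair (Complex.exp (2 * Real.pi * Complex.I / d)) V v w) {i : ℕ}
    (hi : 2 * i ≤ d) :
    d * D.numInv (D.cosetPow w i) = 2 * i * D.numInv (D.coLongest (rePart E v)) := by
  classical
  set p := rePart E v with hp
  -- Translating by `(wφ)^k` permutes the reflections not fixing `p`, so the hyperplanes between the
  -- orbit points `k` and `k + i` are equally many for every `k`.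
  have h1 : ∀ k : ℕ, D.numInv (D.cosetPow w i) = ((D.T.filter fun t => t p ≠ p).filter fun t =>
      D.root t (((w * D.φ) ^ k) p) * D.root t (((w * D.φ) ^ (k + i)) p) < 0).card := by
    intro k
    have e : D.numInv (D.cosetPow w i) =
        (D.T.filter fun t => t p ≠ p ∧ D.root t (((w * D.φ) ^ i) p) < 0).card := by
      rw [numInv, negRoots]
      congr 1
      ext t
      simp only [Finset.mem_filter]
      exact and_congr_right fun ht => h.root_cosetPow_neg_iff i ht
    rw [e, Finset.filter_filter]
    refine (card_filter_conj (h.mem_normalizer k) fun t ht => ?_).symm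
    rw [Ne, Ne, h.conj_pow_apply_eq_iff k ht]
    refine and_congr_right fun htv => ?_
    obtain ⟨c, hc, hr, hpos⟩ := h.exists_root_pow_apply k ht htv
    rw [pow_add]
    change _ * D.root t (((w * D.φ) ^ k) (((w * D.φ) ^ i) p)) < 0 ↔ _
    rw [hr, hr, mul_mul_mul_comm, mul_neg_iff_neg_right (mul_self_pos.2 hc),
      mul_neg_iff_neg_right hpos]
  have h2 : ∀ t ∈ D.T.filter fun t => t p ≠ p, ((Finset.range d).filter fun k =>
      D.root t (((w * D.φ) ^ k) p) * D.root t (((w * D.φ) ^ (k + i)) p) < 0).card = 2 * i := by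
    intro t ht
    obtain ⟨ht, htv⟩ := Finset.mem_filter.1 ht
    refine card_sign_changes hd hi (fun k => D.root t (((w * D.φ) ^ k) p))
      (D.root t (rePart E v)) (D.root t (imPart E v)) (fun k => ?_) (fun k => ?_)
    · rw [hp, h.pow_apply, rePart_smul, exp_pow_eq, Complex.exp_ofReal_mul_I_re,
        Complex.exp_ofReal_mul_I_im, map_sub, map_smul, map_smul, smul_eq_mul, smul_eq_mul]
    · obtain ⟨c, hc, hr, hpos⟩ := h.exists_root_pow_apply k ht htv
      rw [hr]
      exact mul_ne_zero hc hpos.ne'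
  -- Double count of the pairs `(k, t)` for which the hyperplane of `t` separates the orbit points
  -- `k` and `k + i`.
  have h3 := Finset.sum_card_bipartiteAbove_eq_sum_card_bipartiteBelow
    (s := Finset.range d) (t := D.T.filter fun t => t p ≠ p) (fun k t =>
      D.root t (((w * D.φ) ^ k) p) * D.root t (((w * D.φ) ^ (k + i)) p) < 0)
  simp only [Finset.bipartiteAbove, Finset.bipartiteBelow] at h3
  rw [Finset.sum_congr rfl h2, Finset.sum_congr rfl fun k _ => (h1 k).symm] at h3
  simp only [Finset.sum_const, Finset.card_range, smul_eq_mul] at h3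
  rw [h3, numInv_coLongest h.dominant, mul_comm]

/-- The length formula for `i` is compared with its case `i = 1`, which is available only for `d ≥
2`. -/
theorem numInv_cosetPow (hd : 2 ≤ d)
    (h : D.IsGoodPair (Complex.exp (2 * Real.pi * Complex.I / d)) V v w) {i : ℕ}
    (hi : 2 * i ≤ d) : D.numInv (D.cosetPow w i) = i * D.numInv w := by
  have h1 := h.mul_numInv_cosetPow (by omega) hi
  have h2 := h.mul_numInv_cosetPow (i := 1) (by omega) (by omega)
  rw [cosetPow_one] at h2
  refine Nat.eq_of_mul_eq_mul_left (show 0 < d by omega) ?_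
  rw [h1, mul_left_comm, h2]
  ring

/-- Up to half a turn each further factor adds its full length, so the product of the lifts is still
a canonical lift. -/
theorem twistedPow_eq_canonicalLift (hd : 2 ≤ d)
    (h : D.IsGoodPair (Complex.exp (2 * Real.pi * Complex.I / d)) V v w) {k : ℕ}
    (hk : 2 * k ≤ d) :
    twistedPow D.φmon (canonicalLift D.S w) k = canonicalLift D.S (D.cosetPow w k) := by
  induction k with
  | zero => simp [twistedPow, canonicalLift_one]
  | succ k ih =>
    rw [twistedPow_succ, ih (by omega), φmon_pow_canonicalLift h.mem_W, cosetPow_add,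
      cosetPow_one, canonicalLift_mul (cosetPow_mem h.mem_W k) (φ_pow_mul_mem h.mem_W k)]
    have h1 := h.numInv_cosetPow hd hk
    rw [cosetPow_add, cosetPow_one] at h1
    rw [h1, numInv_conj_φ_pow h.mem_W, h.numInv_cosetPow hd (by omega)]
    ring

/-- The `d`-th power of the lift of `w φ` is `π/π_I`, up to `φ^d`. -/
theorem twistedPow_eq_piQuot (hd : 2 ≤ d)
    (h : D.IsGoodPair (Complex.exp (2 * Real.pi * Complex.I / d)) V v w) :
    twistedPow D.φmon (canonicalLift D.S w) d = D.piQuot (rePart E v) := by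
  -- The full turn is two half turns of `k` steps, with one middle step when `d` is odd.
  obtain ⟨k, r, hr, rfl⟩ : ∃ k r, r ≤ 1 ∧ d = k + r + k := ⟨d / 2, d % 2, by omega, by omega⟩
  set κ := D.coLongest (rePart E v) with hκ
  have hκW : κ ∈ D.W := D.coLongest_mem _
  have hxW : ∀ j, D.cosetPow w j ∈ D.W := cosetPow_mem h.mem_W
  set x := D.cosetPow w k with hx
  set y := D.cosetPow w (k + r) with hy
  -- The component of `(wφ)^d` is trivial, so its last `k` factors multiply to `y⁻¹`; in particular
  -- `y` has the length of `x`, though `k + r` may exceed `d / 2`.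
  have hy' : y⁻¹ = D.φ ^ (k + r) * x * (D.φ ^ (k + r))⁻¹ := by
    have h1 := h.cosetPow_eq_one (exp_pow_self (by omega))
    rw [cosetPow_add] at h1
    exact inv_eq_of_mul_eq_one_right h1
  have hxy : x⁻¹ * y = D.φ ^ k * D.cosetPow w r * (D.φ ^ k)⁻¹ := by
    rw [hy, cosetPow_add, inv_mul_cancel_left]
  have hnx : D.numInv x = k * D.numInv w := h.numInv_cosetPow hd (by omega)
  have hny : D.numInv y = k * D.numInv w := by
    rw [← numInv_inv (hxW _), hy', numInv_conj_φ_pow (hxW _), hnx]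
  have hnr : D.numInv (x⁻¹ * y) = r * D.numInv w := by
    rw [hxy, numInv_conj_φ_pow (hxW _), h.numInv_cosetPow hd (by omega)]
  have hκn : (k + r + k) * D.numInv w = 2 * D.numInv κ := by
    simpa using h.mul_numInv_cosetPow (i := 1) (by omega) (by omega)
  have hκx := numInv_coLongest_eq_add h.dominant (hxW k) fun t ht hneg =>
    ((h.root_cosetPow_neg_iff k ht).1 hneg).1
  have hκy := numInv_coLongest_eq_add h.dominant (hxW (k + r)) fun t ht hneg =>
    ((h.root_cosetPow_neg_iff (k + r) ht).1 hneg).1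
  rw [← hκ, ← hx] at hκx
  rw [← hκ, ← hy] at hκy
  have hxκW : x⁻¹ * κ ∈ D.W := mul_mem (inv_mem (hxW _)) hκW
  have hyκW : y⁻¹ * κ ∈ D.W := mul_mem (inv_mem (hxW _)) hκW
  have hz : D.numInv (κ⁻¹ * y) = D.numInv (y⁻¹ * κ) := by
    rw [← numInv_inv hyκW, mul_inv_rev, inv_inv]
  have hzW : κ⁻¹ * y ∈ D.W := mul_mem (inv_mem hκW) (hxW _)
  have e1 : canonicalLift D.S κ = canonicalLift D.S x * canonicalLift D.S (x⁻¹ * κ) := by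
    rw [← canonicalLift_mul (hxW _) hxκW, mul_inv_cancel_left]
    rw [mul_inv_cancel_left, hκx]
  have e2 : canonicalLift D.S κ⁻¹ =
      canonicalLift D.S (κ⁻¹ * y) * canonicalLift D.S y⁻¹ := by
    rw [← canonicalLift_mul hzW (inv_mem (hxW _)), mul_inv_cancel_right]
    rw [mul_inv_cancel_right, numInv_inv hκW, hz, numInv_inv (hxW _), hκy, add_comm]
  -- Lengths add because `2 l(κ) - l(x) - l(y) = d l(w) - 2k l(w) = r l(w)`.
  have e3 : canonicalLift D.S (x⁻¹ * κ) * canonicalLift D.S (κ⁻¹ * y) =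
      canonicalLift D.S (x⁻¹ * y) := by
    have e : x⁻¹ * κ * (κ⁻¹ * y) = x⁻¹ * y := by group
    rw [← canonicalLift_mul hxκW hzW, e]
    rw [e, hnr, hz]
    have : (k + r + k) * D.numInv w = k * D.numInv w + r * D.numInv w + k * D.numInv w := by ring
    omega
  -- The lifts of `x`, `x⁻¹ y` and `y⁻¹` are the blocks of `k`, `r` and `k` factors of the twisted
  -- power.
  rw [piQuot, ← hκ, e1, e2, mul_assoc, ← mul_assoc (canonicalLift D.S (x⁻¹ * κ)), e3,
    twistedPow_add, twistedPow_add, h.twistedPow_eq_canonicalLift hd (by omega),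
    h.twistedPow_eq_canonicalLift hd (by omega), φmon_pow_canonicalLift (hxW _),
    φmon_pow_canonicalLift (hxW _), ← hxy, ← hx, ← hy', mul_assoc]

end

end IsGoodPair

theorem isLift_piQuot (p : E) : IsLift D.S (D.piQuot p) 1 := by
  obtain ⟨L, hL, hL'⟩ := exists_word_canonicalLift (D.coLongest_mem p)
  obtain ⟨M, hM, hM'⟩ := exists_word_canonicalLift (inv_mem (D.coLongest_mem p))
  refine ⟨L ++ M, (prod_map_coe_eq_wordProd _).trans ?_, ?_⟩
  · rw [wordProd_append, hL, hM, mul_inv_cancel]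
  · change monProd (L ++ M) = _
    rw [monProd_append, hL', hM', piQuot]

end RealReflectionCoset

/-! ### The main theorem -/

open RealReflectionCoset in
theorem mainTheorem2 {E : Type*} [AddCommGroup E] [Module ℝ E] [FiniteDimensional ℝ E]
    (D : RealReflectionCoset E) (d : ℕ) (hd : 0 < d) (ζ : ℂ)
    (hζ : ζ = Complex.exp (2 * Real.pi * Complex.I / d))
    (V : Submodule ℂ (TensorProduct ℝ ℂ E))
    (hV : ∃ g ∈ D.W, RealReflectionCoset.ActsBy (g * D.φ) ζ V) :
    ∃ x ∈ D.W, ∃ V' : Submodule ℂ (TensorProduct ℝ ℂ E),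
      V' = V.map (RealReflectionCoset.cx x) ∧
      ∃ I ⊆ D.S, D.fixator V' = (Subgroup.closure I : Set (E ≃ₗ[ℝ] E)) ∧
      (∃ w, D.IsReducedRep ζ V' I w) ∧
      -- `q` is the element `π/π_I` of the braid monoid
      ∃ q : D.Bmon, q * D.piI I = D.piFull ∧ D.piI I * q = D.piFull ∧
      ∀ w, D.IsReducedRep ζ V' I w →
        (d ≠ 1 →
          ((D.len w : ℚ) = 2 / d * D.len (D.w₀ * (D.wI I)⁻¹)) ∧
          (∀ i : ℕ, 2 * i ≤ d → D.len ((w * D.φ) ^ i * (D.φ ^ i)⁻¹) = i * D.len w) ∧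
          D.Stabilizes (Braid.canonicalLift D.S w) I ∧
          -- `(bw φ)^d = φ^d π/π_I`, in the monoid and in `B ⋊ ⟨φ⟩`
          Braid.twistedPow D.φmon (Braid.canonicalLift D.S w) d = (D.φmon ^ d) q ∧
          (D.toBφ (Braid.canonicalLift D.S w) * D.φelt) ^ d =
            D.φelt ^ d * (D.toBφ D.piFull * (D.toBφ (D.piI I))⁻¹)) ∧
        (d = 1 →
          w = 1 ∧ Braid.IsLift D.S q w ∧
          D.Stabilizes q I ∧
          Braid.twistedPow D.φmon q d = q ∧
          (D.toBφ q * D.φelt) ^ d =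
            (D.toBφ D.piFull * (D.toBφ (D.piI I))⁻¹) * D.φelt ^ d) := by
  have hζ0 : ζ ≠ 0 := hζ ▸ Complex.exp_ne_zero _
  obtain ⟨x, hx, v, hv⟩ := exists_isGoodVector (D := D) V
  have hV' : ∃ g ∈ D.W, ActsBy (g * D.φ) ζ (V.map (cx x)) := by
    obtain ⟨g, hg, hact⟩ := hV
    -- This is the `W`-component of `x (g φ) x⁻¹`.
    refine ⟨x * g * (D.φ * x⁻¹ * D.φ⁻¹), mul_mem (mul_mem hx hg) (φ_mul_mem (inv_mem hx)), ?_⟩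
    rintro _ ⟨u, hu, rfl⟩
    rw [← cx_mul, show x * g * (D.φ * x⁻¹ * D.φ⁻¹) * D.φ * x = x * (g * D.φ) by group, cx_mul,
      hact u hu, map_smul]
  have hq : D.toBφ D.piFull * (D.toBφ (D.piI (D.wallsAt (rePart E v))))⁻¹ =
      D.toBφ (D.piQuot (rePart E v)) := by
    rw [← piQuot_mul_piI hv.dominant, map_mul, mul_inv_cancel_right]
  refine ⟨x, hx, _, rfl, D.wallsAt (rePart E v), wallsAt_subset _, hv.fixator_eq,
    hv.exists_isReducedRep hζ0 hV', D.piQuot (rePart E v), piQuot_mul_piI hv.dominant,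
    piI_mul_piQuot hv.dominant, fun w hw => ?_⟩
  have h := hv.isGoodPair hζ0 hw
  subst hζ
  rw [hq]
  constructor
  · intro hd1
    have hd2 : 2 ≤ d := by omega
    -- Since `ζ ^ d = 1`, `φ ^ d` fixes `p` and hence `π/π_I`, so `φ ^ d` may be written on the
    -- left.
    have htw : twistedPow D.φmon (canonicalLift D.S w) d =
        (D.φmon ^ d) (D.piQuot (rePart E v)) := by
      rw [h.twistedPow_eq_piQuot hd2, φmon_pow_piQuot hv.dominant
        (h.φ_pow_apply (IsGoodPair.exp_pow_self hd))]
    refine ⟨?_, fun i hi => ?_, h.stabilizes_canonicalLift, htw, ?_⟩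
    · rw [wI_inv hv.dominant, ← coLongest_inv hv.dominant, len_eq_numInv h.mem_W,
        len_eq_numInv (inv_mem (D.coLongest_mem _)), numInv_inv (D.coLongest_mem _)]
      have h1 := h.mul_numInv_cosetPow (i := 1) hd (by omega)
      rw [cosetPow_one, mul_one] at h1
      have h2 : (d : ℚ) ≠ 0 := by exact_mod_cast hd.ne'
      field_simp
      rw [mul_comm]
      exact_mod_cast h1
    · rw [len_eq_numInv h.mem_W]
      exact (len_eq_numInv (cosetPow_mem h.mem_W i)).trans (h.numInv_cosetPow hd2 hi)
    · rw [toBφ_mul_φelt_pow, htw, φelt_pow_mul_toBφ]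
  · rintro rfl
    have hw1 : w = 1 := by
      have := h.cosetPow_eq_one (IsGoodPair.exp_pow_self one_pos)
      rwa [cosetPow_one] at this
    subst hw1
    have htw : twistedPow D.φmon (D.piQuot (rePart E v)) 1 = D.piQuot (rePart E v) := by
      simp [twistedPow]
    exact ⟨rfl, isLift_piQuot _, h.stabilizes_piQuot, htw, by rw [toBφ_mul_φelt_pow, htw]⟩
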